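/- There are constants $c,\delta\in\mathbb{N}$ and a family $\{M_n\}_{n\ge 1}$ of finite directed acyclic graphs such that, for every $n\ge 1$: $M_n$ has at most $cn$ nodes; every node of $M_n$ has indegree at most $\delta$; $M_n$ has exactly $n$ inputs (nodes of indegree $0$, forming the set $I_n$) and exactly $n$ outputs (nodes of outdegree $0$, forming the set $O_n$); and $M_n$ is maximally ST-robust. The latter means that for every integer $0\le k\le n$ and every set $D\subseteq V(M_n)$ with $|D|\le k$ there is a subgraph $H$ of $M_n-D$ with $|I_n\cap V(H)|\ge n-k$ and $|O_n\cap V(H)|\ge n-k$ such that for all $s\in I_n\cap V(H)$ and $t\in O_n\cap V(H)$ there is a directed path from $s$ to $t$ in $H$. -/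

import Mathlib

namespace STRobust

/-- A directed graph is acyclic (a DAG) if no vertex lies on a closed directed walk of positive
length; in particular there are no loops. -/
def IsAcyclic {V : Type*} (G : Digraph V) : Prop :=
  ∀ v : V, ¬ Relation.TransGen G.Adj v v

/-- The vertices of indegree zero. -/
def sources {V : Type*} (G : Digraph V) : Set V := {v | ∀ u, ¬ G.Adj u v}

/-- The vertices of outdegree zero. -/
def sinks {V : Type*} (G : Digraph V) : Set V := {v | ∀ w, ¬ G.Adj v w}

/-- The number of edges entering `v` (used for finite graphs). -/
noncomputable def indegree {V : Type*} (G : Digraph V) (v : V) : ℕ := {u | G.Adj u v}.ncard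

/-- A (not necessarily induced) subgraph: a set of vertices together with some of the edges of `G`
between them. -/
structure Subdigraph {V : Type*} (G : Digraph V) where
  verts : Set V
  Adj : V → V → Prop
  adj_sub : ∀ {u v : V}, Adj u v → G.Adj u v
  tail_mem : ∀ {u v : V}, Adj u v → u ∈ verts
  head_mem : ∀ {u v : V}, Adj u v → v ∈ verts

/-- The finite digraph `G` with input set `I` and output set `O` is `(k₁, k₂)`-ST-robust: for every
set `D` of at most `k₁` vertices, `G - D` has a subgraph `H` with at least `k₂` inputs and at least
`k₂` outputs in which every input has a directed path to every output. -/
def IsSTRobust {V : Type*} (G : Digraph V) (I O : Set V) (k₁ k₂ : ℕ) : Prop :=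
  ∀ D : Finset V, D.card ≤ k₁ →
    ∃ H : Subdigraph G, Disjoint H.verts (D : Set V) ∧
      k₂ ≤ (I ∩ H.verts).ncard ∧ k₂ ≤ (O ∩ H.verts).ncard ∧
      ∀ s ∈ I ∩ H.verts, ∀ t ∈ O ∩ H.verts, Relation.ReflTransGen H.Adj s t

/-- `G` has `n` inputs and `n` outputs and is `(k, n - k)`-ST-robust for all `0 ≤ k ≤ n`. -/
def IsMaximallySTRobust {V : Type*} (G : Digraph V) (I O : Set V) (n : ℕ) : Prop :=
  I.ncard = n ∧ O.ncard = n ∧ ∀ k ≤ n, IsSTRobust G I O k (n - k)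

end STRobust

/-! It is enough to find a sparse acyclic graph with `n` inputs and `n` outputs in which, whatever
set `D` of fewer than `n` vertices is deleted, some vertex `z` is reached from all but `|D|` inputs
and reaches all but `|D|` outputs. The vertices joined to `z` by a path outside `D` then form the
required subgraph (`exists_subdigraph_of_center`). Only the number of edges has to be linear at
first: `reduction` brings the indegree down to 2, and each vertex it creates is charged to one old
vertex.

The graph of `exists_core` is a linker, followed by a grate, followed by the reversed linker. The
grate (`exists_grate`) still has, after fewer than `2 ^ a` deletions, a vertex with a positive
proportion of ancestors in its first copy and of descendants in its last. The linker
(`exists_linker`) turns proportions into exact counts: after `k` deletions of vertices other than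
inputs, any `k + 1` surviving inputs reach every dense set. It is recursive, in the manner of
superconcentrators: an expander into half as many inputs doubles small sets, a disperser deals with
large ones, and the costs form a geometric series.

A copy of the grate is the product of a sparse acyclic graph on a set `R`, of size polynomial in
`a`, with a sparse disperser on `W = R × U`. Along a walk of levels longer than `log |W|`, none of
which has lost much, repeated halving (`exists_single_reaching`) shows that most vertices of the
first level reach almost all of the last. The transposition of `R × (R × U)` then spreads one level
of the middle copy over all levels of the outer copies, where many walks with distinct ends carry it
to a positive proportion of the vertices.

This needs a graph on `R` with bounded average degree that keeps walks of length of order `a` after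
a small proportion of its vertices is deleted (`exists_depthRobust`). Its vertices are leaves of a
binary tree with two scales, and dispersers lead from the left to the right of each tree node.
Without long walks there is a ranking with few values, hence a threshold at every tree node.
Comparing these thresholds with a single number predicts almost every turn on the branch to a
typical leaf, so typical leaves would have descriptions that are too short. -/

namespace STRobust

open Relation

/-! ### Random bipartite graphs: dispersers -/

/-- The union bound: if the bad sets are too small to cover, some point avoids all of them. -/
theorem exists_forall_notMem_of_sum_card_lt {Ω ι : Type*} [Fintype Ω] [DecidableEq Ω]
    (s : Finset ι) (bad : ι → Finset Ω)
    (h : ∑ i ∈ s, (bad i).card < Fintype.card Ω) : ∃ ω, ∀ i ∈ s, ω ∉ bad i := by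
  by_contra! hcon
  have hsub : (Finset.univ : Finset Ω) ⊆ s.biUnion bad := by
    intro ω _
    obtain ⟨i, hi, hω⟩ := hcon ω
    exact Finset.mem_biUnion.2 ⟨i, hi, hω⟩
  have h1 := Finset.card_le_card hsub
  have h2 := Finset.card_biUnion_le (s := s) (t := bad)
  rw [Finset.card_univ] at h1
  omega

/-- The functions `f : Y → Fin d → X` all of whose values on `B` lie in `A`. -/
theorem card_piFinset_ite {X Y : Type*} [Fintype X] [Fintype Y] [DecidableEq X] [DecidableEq Y]
    (d : ℕ) (A : Finset X) (B : Finset Y) :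
    (Fintype.piFinset (fun y : Y =>
      if y ∈ B then Fintype.piFinset (fun _ : Fin d => A) else Finset.univ)).card
      = (A.card ^ d) ^ B.card * ((Fintype.card X) ^ d) ^ (Fintype.card Y - B.card) := by
  classical
  rw [Fintype.card_piFinset]
  have : ∀ y : Y, (if y ∈ B then Fintype.piFinset (fun _ : Fin d => A) else Finset.univ).card
      = if y ∈ B then A.card ^ d else (Fintype.card X) ^ d := by
    intro y
    split_ifs <;> simp
  simp only [this]
  rw [Finset.prod_ite]
  simp only [Finset.prod_const]
  congr 2
  · simp
  · have : Finset.univ.filter (fun y => y ∉ B) = Bᶜ := by ext; simp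
    rw [this, Finset.card_compl]

/-- The factor 4 pays for the at most `4 ^ n` pairs of subsets in the union bound below. -/
theorem exists_mul_pow_lt_pow (K : ℕ) (hK : 1 ≤ K) : ∃ m : ℕ, 4 * (K - 1) ^ m < K ^ m := by
  have hK' : (0 : ℝ) < K := by exact_mod_cast hK
  have h0 : (0 : ℝ) ≤ ((K - 1 : ℕ) : ℝ) / K := by positivity
  have h1 : ((K - 1 : ℕ) : ℝ) / K < 1 := by
    rw [div_lt_one hK']
    exact_mod_cast Nat.sub_lt hK one_pos
  obtain ⟨m, hm⟩ := exists_pow_lt_of_lt_one (show (0 : ℝ) < 1 / 4 by norm_num) h1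
  refine ⟨m, ?_⟩
  rw [div_pow, div_lt_iff₀ (by positivity)] at hm
  have : (4 : ℝ) * ((K - 1 : ℕ) : ℝ) ^ m < (K : ℝ) ^ m := by linarith
  exact_mod_cast this

/-- Each `y` chooses `K * m` random neighbours in `X`. For a dense pair `(A, B)` the chance that all
choices from `B` miss `A` is at most `((K - 1) / K) ^ (K * m * |B|)`; since `K * |B| ≥ |Y|`, this is
below `4 ^ (-|Y|)`, while `|X| ≤ |Y|` leaves at most `4 ^ |Y|` pairs. -/
theorem exists_disperser_of_card_le (K : ℕ) (hK : 1 ≤ K) : ∃ δ : ℕ, ∀ (X Y : Type) [Fintype X]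
    [Fintype Y], 0 < Fintype.card X → Fintype.card X ≤ Fintype.card Y →
    ∃ Q : Finset (X × Y), Q.card ≤ δ * Fintype.card Y ∧
      ∀ (A : Finset X) (B : Finset Y), Fintype.card X ≤ K * A.card → Fintype.card Y ≤ K * B.card →
        ∃ x ∈ A, ∃ y ∈ B, (x, y) ∈ Q := by
  classical
  obtain ⟨m, hm⟩ := exists_mul_pow_lt_pow K hK
  refine ⟨K * m, fun X Y _ _ hX hXY => ?_⟩
  set q := Fintype.card X with hq
  set n := Fintype.card Y with hn
  set d := K * m with hd
  let s : Finset (Finset X × Finset Y) :=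
    Finset.univ.filter (fun p => q ≤ K * p.1.card ∧ n ≤ K * p.2.card)
  let bad : Finset X × Finset Y → Finset (Y → Fin d → X) := fun p =>
    Fintype.piFinset (fun y : Y =>
      if y ∈ p.2 then Fintype.piFinset (fun _ : Fin d => p.1ᶜ) else Finset.univ)
  have hΩ : Fintype.card (Y → Fin d → X) = (q ^ d) ^ n := by simp [hq, hn]
  have hbad : ∀ p ∈ s, 4 ^ n * (bad p).card < (q ^ d) ^ n := by
    rintro ⟨A, B⟩ hp
    obtain ⟨hA, hB⟩ : q ≤ K * A.card ∧ n ≤ K * B.card := by simpa [s] using hp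
    have hAq : A.card ≤ q := Finset.card_le_univ A
    have hBn : B.card ≤ n := Finset.card_le_univ B
    simp only [bad]
    rw [card_piFinset_ite, Finset.card_compl, ← hq, ← hn]
    have h1 : K * (q - A.card) ≤ (K - 1) * q := by
      have e1 : K * (q - A.card) = K * q - K * A.card := Nat.mul_sub _ _ _
      have e2 : (K - 1) * q = K * q - q := Nat.sub_one_mul _ _
      omega
    have h2 : (K * (q - A.card)) ^ (d * B.card) ≤ ((K - 1) * q) ^ (d * B.card) :=
      Nat.pow_le_pow_left h1 _
    rw [mul_pow, mul_pow] at h2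
    have hb : d * B.card = m * (K * B.card) := by rw [hd]; ring
    have hb0 : K * B.card ≠ 0 := by omega
    have h3 : 4 ^ n * (K - 1) ^ (d * B.card) < K ^ (d * B.card) := by
      rw [hb, pow_mul (K - 1) m, pow_mul K m]
      calc 4 ^ n * ((K - 1) ^ m) ^ (K * B.card)
          ≤ 4 ^ (K * B.card) * ((K - 1) ^ m) ^ (K * B.card) :=
            Nat.mul_le_mul_right _ (Nat.pow_le_pow_right (by norm_num) hB)
        _ = (4 * (K - 1) ^ m) ^ (K * B.card) := by rw [mul_pow]
        _ < (K ^ m) ^ (K * B.card) := Nat.pow_lt_pow_left hm hb0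
    have h4 : (q ^ d) ^ n = q ^ (d * B.card) * (q ^ d) ^ (n - B.card) := by
      rw [pow_mul q d, ← pow_add]; congr 1; omega
    rw [h4, ← pow_mul, ← mul_assoc]
    refine Nat.mul_lt_mul_of_pos_right ?_ (by positivity)
    refine lt_of_mul_lt_mul_left (a := K ^ (d * B.card)) ?_ (Nat.zero_le _)
    calc K ^ (d * B.card) * (4 ^ n * (q - A.card) ^ (d * B.card))
        = 4 ^ n * (K ^ (d * B.card) * (q - A.card) ^ (d * B.card)) := by ring
      _ ≤ 4 ^ n * ((K - 1) ^ (d * B.card) * q ^ (d * B.card)) := Nat.mul_le_mul_left _ h2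
      _ = (4 ^ n * (K - 1) ^ (d * B.card)) * q ^ (d * B.card) := by ring
      _ < K ^ (d * B.card) * q ^ (d * B.card) :=
          Nat.mul_lt_mul_of_pos_right h3 (by positivity)
  have hs : s.card ≤ 4 ^ n := by
    calc s.card ≤ Fintype.card (Finset X × Finset Y) := Finset.card_le_univ s
      _ = 2 ^ q * 2 ^ n := by simp [hq, hn]
      _ ≤ 2 ^ n * 2 ^ n := Nat.mul_le_mul_right _ (Nat.pow_le_pow_right (by norm_num) hXY)
      _ = 4 ^ n := by rw [← mul_pow]; norm_num
  have hsne : s.Nonempty := ⟨(Finset.univ, Finset.univ), by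
    simp only [s, Finset.mem_filter, Finset.mem_univ, true_and, Finset.card_univ]
    exact ⟨Nat.le_mul_of_pos_left _ hK, Nat.le_mul_of_pos_left _ hK⟩⟩
  have hsum : ∑ p ∈ s, (bad p).card < Fintype.card (Y → Fin d → X) := by
    rw [hΩ]
    refine lt_of_mul_lt_mul_left (a := 4 ^ n) ?_ (Nat.zero_le _)
    rw [Finset.mul_sum]
    calc ∑ p ∈ s, 4 ^ n * (bad p).card < ∑ p ∈ s, (q ^ d) ^ n :=
          Finset.sum_lt_sum_of_nonempty hsne hbad
      _ = s.card * (q ^ d) ^ n := by simp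
      _ ≤ 4 ^ n * (q ^ d) ^ n := Nat.mul_le_mul_right _ hs
  obtain ⟨f, hf⟩ := exists_forall_notMem_of_sum_card_lt s bad hsum
  refine ⟨(Finset.univ : Finset (Y × Fin d)).image (fun p => (f p.1 p.2, p.1)), ?_, ?_⟩
  · refine Finset.card_image_le.trans ?_
    simp [hn, mul_comm]
  · intro A B hA hB
    have := hf (A, B) (by simp [s, hA, hB])
    simp only [bad, Fintype.mem_piFinset, not_forall] at this
    obtain ⟨y, hy⟩ := this
    split_ifs at hy with hyB
    · simp only [Fintype.mem_piFinset, not_forall, Finset.mem_compl, not_not] at hy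
      obtain ⟨e, he⟩ := hy
      exact ⟨f y e, he, y, hyB, Finset.mem_image.2 ⟨(y, e), Finset.mem_univ _, rfl⟩⟩
    · simp at hy

/-- `Q` joins any two sets of density at least `1 / K`. -/
def IsDisperser {X Y : Type} [Fintype X] [Fintype Y] (K : ℕ) (Q : Finset (X × Y)) : Prop :=
  ∀ (A : Finset X) (B : Finset Y), Fintype.card X ≤ K * A.card → Fintype.card Y ≤ K * B.card →
    ∃ x ∈ A, ∃ y ∈ B, (x, y) ∈ Q

theorem exists_disperser (K : ℕ) (hK : 1 ≤ K) : ∃ δ : ℕ, ∀ (X Y : Type) [Fintype X]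
    [Fintype Y], 0 < Fintype.card X → 0 < Fintype.card Y →
    ∃ Q : Finset (X × Y), Q.card ≤ δ * max (Fintype.card X) (Fintype.card Y) ∧
      IsDisperser K Q := by
  classical
  obtain ⟨δ, hδ⟩ := exists_disperser_of_card_le K hK
  refine ⟨δ, fun X Y _ _ hX hY => ?_⟩
  rcases le_total (Fintype.card X) (Fintype.card Y) with h | h
  · rw [max_eq_right h]
    exact hδ X Y hX h
  · rw [max_eq_left h]
    obtain ⟨Q, hQ, hQ'⟩ := hδ Y X hY h
    refine ⟨Q.image Prod.swap, Finset.card_image_le.trans hQ, fun A B hA hB => ?_⟩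
    obtain ⟨y, hy, x, hx, hxy⟩ := hQ' B A hB hA
    exact ⟨x, hx, y, hy, Finset.mem_image.2 ⟨_, hxy, rfl⟩⟩

/-- If `A` has density at least `1 / K`, fewer than a `1 / K` fraction of the points of `Y` have
no neighbour in `A`. -/
theorem IsDisperser.card_lt_of_forall_notMem {X Y : Type} [Fintype X] [Fintype Y] {K : ℕ}
    {Q : Finset (X × Y)} (hQ : IsDisperser K Q) {A : Finset X} {B : Finset Y}
    (hA : Fintype.card X ≤ K * A.card) (h : ∀ x ∈ A, ∀ y ∈ B, (x, y) ∉ Q) :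
    K * B.card < Fintype.card Y := by
  by_contra! hcon
  obtain ⟨x, hx, y, hy, hxy⟩ := hQ A B hA hcon
  exact h x hx y hy hxy

theorem IsDisperser.swap {X Y : Type} [Fintype X] [Fintype Y] [DecidableEq (Y × X)] {K : ℕ}
    {Q : Finset (X × Y)} (hQ : IsDisperser K Q) : IsDisperser K (Q.image Prod.swap) := by
  intro A B hA hB
  obtain ⟨y, hy, x, hx, hxy⟩ := hQ B A hB hA
  exact ⟨x, hx, y, hy, Finset.mem_image.2 ⟨_, hxy, rfl⟩⟩

/-! ### Random bipartite graphs: expanders -/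

/-- The expected number of `k`-sets whose four-fold random choices stay inside a `2k`-set is at most
`4 ^ (-k)`. By `n ^ n / n! ≤ 3 ^ n` the ratio of the two sides is at most `(864 k / q) ^ k`. Four
choices suffice because the two binomials contribute only `q ^ (3k)` against `q ^ (4k)`. -/
theorem expander_term_le (q k : ℕ) (hk : 1 ≤ k) (hkq : 1000 * k ≤ q) :
    (4 : ℝ) ^ k * ((2 * q).choose k * q.choose (2 * k) * ((((2 * k : ℕ) : ℝ) ^ 4) ^ k)) ≤
      (((q : ℝ) ^ 4) ^ k) := by
  have hq : (0 : ℝ) < q := by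
    have : 0 < q := by omega
    exact_mod_cast this
  have hk0 : (0 : ℝ) < k := by exact_mod_cast hk
  have h1 : (((2 * q).choose k : ℕ) : ℝ) ≤ ((2 * q : ℕ) : ℝ) ^ k / (k.factorial : ℝ) :=
    Nat.choose_le_pow_div k (2 * q)
  have h2 : ((q.choose (2 * k) : ℕ) : ℝ) ≤ (q : ℝ) ^ (2 * k) / ((2 * k).factorial : ℝ) :=
    Nat.choose_le_pow_div (2 * k) q
  have hexp : ∀ n : ℕ, (n : ℝ) ^ n / (n.factorial : ℝ) ≤ 3 ^ n := by
    intro n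
    refine (Real.pow_div_factorial_le_exp (n : ℝ) (by positivity) n).trans ?_
    have : Real.exp n = Real.exp 1 ^ n := by rw [← Real.exp_nat_mul, mul_one]
    rw [this]
    exact pow_le_pow_left₀ (Real.exp_pos _).le (by linarith [Real.exp_one_lt_d9]) _
  have h3 := hexp k
  have h4 := hexp (2 * k)
  have h5 : ((k : ℝ) * 1000) ^ k ≤ (q : ℝ) ^ k :=
    pow_le_pow_left₀ (by positivity) (by exact_mod_cast (by omega : k * 1000 ≤ q)) _
  calc (4 : ℝ) ^ k * ((2 * q).choose k * q.choose (2 * k) * ((((2 * k : ℕ) : ℝ) ^ 4) ^ k))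
      ≤ (4 : ℝ) ^ k * ((((2 * q : ℕ) : ℝ) ^ k / (k.factorial : ℝ)) *
          ((q : ℝ) ^ (2 * k) / ((2 * k).factorial : ℝ)) * ((((2 * k : ℕ) : ℝ) ^ 4) ^ k)) := by
        gcongr
    _ = (32 : ℝ) ^ k * (q : ℝ) ^ (3 * k) * (k : ℝ) ^ k * ((k : ℝ) ^ k / (k.factorial : ℝ)) *
          (((2 * k : ℕ) : ℝ) ^ (2 * k) / ((2 * k).factorial : ℝ)) := by
        push_cast
        have e : (32 : ℝ) ^ k = 4 ^ k * 2 ^ k * 2 ^ (2 * k) := by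
          rw [pow_mul, ← mul_pow, ← mul_pow]; norm_num
        rw [e]
        have e' : (16 : ℝ) ^ k = 2 ^ (2 * k) * 2 ^ (2 * k) := by
          rw [← pow_add, ← two_mul, ← mul_assoc, pow_mul]; norm_num
        field_simp
        ring_nf
        rw [show (16 : ℝ) ^ k = 2 ^ (2 * k) * 2 ^ (2 * k) from e']
        ring
    _ ≤ (32 : ℝ) ^ k * (q : ℝ) ^ (3 * k) * (k : ℝ) ^ k * 3 ^ k * 3 ^ (2 * k) := by
        gcongr
    _ = (864 * k) ^ k * (q : ℝ) ^ (3 * k) := by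
        rw [mul_pow, pow_mul (3 : ℝ)]
        have e : (864 : ℝ) ^ k = 32 ^ k * 3 ^ k * (3 ^ 2) ^ k := by
          rw [← mul_pow, ← mul_pow]; norm_num
        rw [e]; ring
    _ ≤ ((k : ℝ) * 1000) ^ k * (q : ℝ) ^ (3 * k) := by
        refine mul_le_mul_of_nonneg_right (pow_le_pow_left₀ (by positivity) ?_ _) (by positivity)
        linarith
    _ ≤ (q : ℝ) ^ k * (q : ℝ) ^ (3 * k) := by gcongr
    _ = (((q : ℝ) ^ 4) ^ k) := by rw [← pow_add, ← pow_mul]; congr 1; ring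

theorem sum_Icc_quarter_pow_lt_one (n : ℕ) : ∑ k ∈ Finset.Icc 1 n, (1 / 4 : ℝ) ^ k < 1 := by
  have : ∑ k ∈ Finset.Icc 1 n, (1 / 4 : ℝ) ^ k = (1 - (1 / 4) ^ n) / 3 := by
    induction n with
    | zero => simp
    | succ n ih => rw [Finset.sum_Icc_succ_top (by omega), ih, pow_succ]; ring
  rw [this]
  have : (0 : ℝ) < (1 / 4) ^ n := by positivity
  linarith

/-- Sparse graphs from `X` to `Y`, with `Y` half as large as `X`, in which small sets double. -/
theorem exists_expander (X Y : Type) [Fintype X] [Fintype Y]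
    (hXY : Fintype.card X = 2 * Fintype.card Y) (hY : 0 < Fintype.card Y) :
    ∃ Q : Finset (X × Y), Q.card ≤ 4 * Fintype.card X ∧
      ∀ A : Finset X, 1000 * A.card ≤ Fintype.card Y →
        ∃ N : Finset Y, 2 * A.card ≤ N.card ∧ ∀ y ∈ N, ∃ x ∈ A, (x, y) ∈ Q := by
  classical
  set q := Fintype.card Y with hq
  let bad₀ : Finset X → Finset Y → Finset (X → Fin 4 → Y) := fun A B =>
    Fintype.piFinset (fun x : X =>
      if x ∈ A then Fintype.piFinset (fun _ : Fin 4 => B) else Finset.univ)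
  let bad : ℕ → Finset (X → Fin 4 → Y) := fun k =>
    ((Finset.univ : Finset X).powersetCard k ×ˢ
      (Finset.univ : Finset Y).powersetCard (2 * k)).biUnion (fun p => bad₀ p.1 p.2)
  have hq0 : (0 : ℝ) < q := by exact_mod_cast hY
  have hcard : ∀ k ∈ Finset.Icc 1 (q / 1000),
      ((bad k).card : ℝ) ≤ (((q : ℝ) ^ 4) ^ (2 * q)) * (1 / 4) ^ k := by
    intro k hk
    rw [Finset.mem_Icc] at hk
    have hkq : 1000 * k ≤ q := by omega
    have h1 : (bad k).card ≤ (2 * q).choose k * q.choose (2 * k) *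
        (((2 * k) ^ 4) ^ k * (q ^ 4) ^ (2 * q - k)) := by
      refine Finset.card_biUnion_le.trans ?_
      refine (Finset.sum_le_card_nsmul _ _ (((2 * k) ^ 4) ^ k * (q ^ 4) ^ (2 * q - k)) ?_).trans ?_
      · rintro ⟨A, B⟩ hp
        rw [Finset.mem_product, Finset.mem_powersetCard, Finset.mem_powersetCard] at hp
        simp only [bad₀]
        rw [card_piFinset_ite, hp.1.2, hp.2.2, hXY]
      · rw [Finset.card_product, Finset.card_powersetCard, Finset.card_powersetCard,
          Finset.card_univ, Finset.card_univ, hXY, smul_eq_mul]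
    have h1' : ((bad k).card : ℝ) ≤ (2 * q).choose k * q.choose (2 * k) *
        ((((2 * k : ℕ) : ℝ) ^ 4) ^ k * ((q : ℝ) ^ 4) ^ (2 * q - k)) := by exact_mod_cast h1
    have h2 := expander_term_le q k hk.1 hkq
    have h3 : (((q : ℝ) ^ 4) ^ (2 * q)) = ((q : ℝ) ^ 4) ^ k * ((q : ℝ) ^ 4) ^ (2 * q - k) := by
      rw [← pow_add]; congr 1; omega
    rw [h3]
    refine h1'.trans ?_
    have h4 : (1 / 4 : ℝ) ^ k * 4 ^ k = 1 := by rw [← mul_pow]; norm_num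
    calc ((2 * q).choose k : ℝ) * q.choose (2 * k) *
        ((((2 * k : ℕ) : ℝ) ^ 4) ^ k * ((q : ℝ) ^ 4) ^ (2 * q - k))
        = ((1 / 4 : ℝ) ^ k * 4 ^ k) * (((2 * q).choose k : ℝ) * q.choose (2 * k) *
        ((((2 * k : ℕ) : ℝ) ^ 4) ^ k * ((q : ℝ) ^ 4) ^ (2 * q - k))) := by rw [h4, one_mul]
      _ = (1 / 4 : ℝ) ^ k * ((4 : ℝ) ^ k * ((2 * q).choose k * q.choose (2 * k) *
        ((((2 * k : ℕ) : ℝ) ^ 4) ^ k))) * ((q : ℝ) ^ 4) ^ (2 * q - k) := by ring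
      _ ≤ (1 / 4 : ℝ) ^ k * ((q : ℝ) ^ 4) ^ k * ((q : ℝ) ^ 4) ^ (2 * q - k) := by gcongr
      _ = _ := by ring
  have hsum : ∑ k ∈ Finset.Icc 1 (q / 1000), (bad k).card < Fintype.card (X → Fin 4 → Y) := by
    have hΩ : Fintype.card (X → Fin 4 → Y) = (q ^ 4) ^ (2 * q) := by simp [hXY, ← hq]
    rw [hΩ]
    have : (∑ k ∈ Finset.Icc 1 (q / 1000), ((bad k).card : ℝ)) < ((q : ℝ) ^ 4) ^ (2 * q) := by
      refine (Finset.sum_le_sum hcard).trans_lt ?_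
      rw [← Finset.mul_sum]
      exact mul_lt_of_lt_one_right (by positivity) (sum_Icc_quarter_pow_lt_one _)
    exact_mod_cast this
  obtain ⟨f, hf⟩ := exists_forall_notMem_of_sum_card_lt _ bad hsum
  refine ⟨(Finset.univ : Finset (X × Fin 4)).image (fun p => (p.1, f p.1 p.2)), ?_, ?_⟩
  · refine Finset.card_image_le.trans ?_
    simp [mul_comm]
  · intro A hA
    have key : ∀ Nb : Finset Y, (∀ x ∈ A, ∀ e, f x e ∈ Nb) → 2 * A.card ≤ Nb.card := by
      intro Nb hNb
      by_contra! hcon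
      have hA0 : 1 ≤ A.card := by omega
      have hA1 : A.card ≤ q / 1000 := by omega
      have hY2 : 2 * A.card ≤ (Finset.univ : Finset Y).card := by rw [Finset.card_univ]; omega
      -- The union bound runs over target sets of size exactly `2 * |A|`, so a smaller neighbourhood
      -- is first enlarged.
      obtain ⟨B, hB, -, hBc⟩ :=
        Finset.exists_subsuperset_card_eq (Finset.subset_univ Nb) hcon.le hY2
      have hfA := hf A.card (Finset.mem_Icc.2 ⟨hA0, hA1⟩)
      apply hfA
      simp only [bad, Finset.mem_biUnion, Finset.mem_product, Finset.mem_powersetCard]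
      refine ⟨(A, B), ⟨⟨Finset.subset_univ _, rfl⟩, Finset.subset_univ _, hBc⟩, ?_⟩
      simp only [bad₀, Fintype.mem_piFinset]
      intro x
      split_ifs with hx
      · rw [Fintype.mem_piFinset]
        exact fun e => hB (hNb x hx e)
      · exact Finset.mem_univ _
    refine ⟨(A ×ˢ Finset.univ).image (fun p => f p.1 p.2), key _ fun x hx e => ?_, ?_⟩
    · exact Finset.mem_image.2 ⟨(x, e), by simp [hx], rfl⟩
    · intro y hy
      obtain ⟨⟨x, e⟩, hp, rfl⟩ := Finset.mem_image.1 hy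
      exact ⟨x, (Finset.mem_product.1 hp).1,
        Finset.mem_image.2 ⟨(x, e), Finset.mem_univ _, rfl⟩⟩

/-! ### Walks and rankings -/

/-- `Walk r n u v`: there is a walk of length `n` from `u` to `v` along `r`. -/
def Walk {V : Type*} (r : V → V → Prop) : ℕ → V → V → Prop
  | 0, u, v => u = v
  | n + 1, u, v => ∃ w, r u w ∧ Walk r n w v

theorem Walk.snoc {V : Type*} {r : V → V → Prop} {n : ℕ} {u v w : V} (h : Walk r n u v)
    (hvw : r v w) : Walk r (n + 1) u w := by
  induction n generalizing u with
  | zero => cases h; exact ⟨w, hvw, rfl⟩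
  | succ n ih =>
    obtain ⟨x, hx, hxv⟩ := h
    exact ⟨x, hx, ih hxv⟩

theorem Walk.split {V : Type*} {r : V → V → Prop} {m n : ℕ} {u v : V} (h : Walk r (m + n) u v) :
    ∃ w, Walk r m u w ∧ Walk r n w v := by
  induction m generalizing u with
  | zero => exact ⟨u, rfl, by simpa using h⟩
  | succ m ih =>
    rw [Nat.succ_add] at h
    obtain ⟨x, hx, hxv⟩ := h
    obtain ⟨w, h1, h2⟩ := ih hxv
    exact ⟨w, ⟨x, hx, h1⟩, h2⟩

theorem Walk.flip {V : Type*} {r : V → V → Prop} {n : ℕ} {u v : V} (h : Walk r n u v) :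
    Walk (fun x y => r y x) n v u := by
  induction n generalizing u with
  | zero => exact Eq.symm h
  | succ n ih =>
    obtain ⟨x, hx, hxv⟩ := h
    exact (ih hxv).snoc hx

theorem Walk.mono {V : Type*} {r r' : V → V → Prop} (hr : ∀ u v, r u v → r' u v) {n : ℕ} {u v : V}
    (h : Walk r n u v) : Walk r' n u v := by
  induction n generalizing u with
  | zero => exact h
  | succ n ih =>
    obtain ⟨x, hx, hxv⟩ := h
    exact ⟨x, hr _ _ hx, ih hxv⟩

/-- If there are no walks of length `ℓ`, then some ranking with values below `ℓ` increases along
every edge. -/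
theorem exists_rank_of_forall_not_walk {V : Type*} (r : V → V → Prop) (ℓ : ℕ)
    (h : ∀ u v, ¬ Walk r ℓ u v) : ∃ f : V → ℕ, (∀ v, f v < ℓ) ∧ ∀ u v, r u v → f u < f v := by
  classical
  let P : V → ℕ → Prop := fun v m => ∃ u, Walk r m u v
  -- The rank of `v` is the greatest length, capped at `ℓ`, of a walk ending at `v`; the value `ℓ`
  -- itself is excluded by `h`.
  let f : V → ℕ := fun v => Nat.findGreatest (P v) ℓ
  have hP : ∀ v, P v (f v) := fun v =>
    Nat.findGreatest_spec (P := P v) (m := 0) (Nat.zero_le _) ⟨v, rfl⟩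
  have hlt : ∀ v, f v < ℓ := by
    intro v
    refine lt_of_le_of_ne (Nat.findGreatest_le _) fun heq => ?_
    obtain ⟨u, hu⟩ := hP v
    rw [heq] at hu
    exact h u v hu
  refine ⟨f, hlt, fun u v huv => ?_⟩
  obtain ⟨x, hx⟩ := hP u
  exact Nat.le_findGreatest (P := P v) (hlt u) ⟨x, hx.snoc huv⟩

/-! ### Thresholds, cuts and counting of error sets -/

theorem exists_disperser_finset (K : ℕ) (hK : 1 ≤ K) : ∃ δ : ℕ, ∀ (V : Type) (U W : Finset V),
    U.Nonempty → W.Nonempty →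
    ∃ Q : Finset (V × V), Q.card ≤ δ * (U.card + W.card) ∧ (∀ e ∈ Q, e.1 ∈ U ∧ e.2 ∈ W) ∧
      ∀ A ⊆ U, ∀ B ⊆ W, U.card ≤ K * A.card → W.card ≤ K * B.card →
        ∃ x ∈ A, ∃ y ∈ B, (x, y) ∈ Q := by
  classical
  obtain ⟨δ, hδ⟩ := exists_disperser K hK
  refine ⟨δ, fun V U W hU hW => ?_⟩
  obtain ⟨Q, hQ, hQ'⟩ := hδ U W (by simpa using hU) (by simpa using hW)
  refine ⟨Q.image (fun e => (e.1.1, e.2.1)), ?_, ?_, ?_⟩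
  · refine Finset.card_image_le.trans (hQ.trans (Nat.mul_le_mul_left _ ?_))
    simp only [Fintype.card_coe]
    omega
  · intro e he
    obtain ⟨x, -, rfl⟩ := Finset.mem_image.1 he
    exact ⟨x.1.2, x.2.2⟩
  · intro A hA B hB h1 h2
    have e1 : (A.subtype (· ∈ U)).card = A.card := by
      rw [Finset.card_subtype, Finset.filter_true_of_mem fun x hx => hA hx]
    have e2 : (B.subtype (· ∈ W)).card = B.card := by
      rw [Finset.card_subtype, Finset.filter_true_of_mem fun x hx => hB hx]
    obtain ⟨x, hx, y, hy, hxy⟩ := hQ' (A.subtype (· ∈ U)) (B.subtype (· ∈ W))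
      (by rw [e1, Fintype.card_coe]; exact h1) (by rw [e2, Fintype.card_coe]; exact h2)
    exact ⟨x, Finset.mem_subtype.1 hx, y, Finset.mem_subtype.1 hy,
      Finset.mem_image.2 ⟨_, hxy, rfl⟩⟩

/-- Across a disperser, a ranking that increases along edges is separated by a threshold. -/
theorem exists_threshold {V : Type} [DecidableEq V] {K : ℕ} {U W S : Finset V}
    {E : Finset (V × V)}
    (hE : ∀ A ⊆ U, ∀ B ⊆ W, U.card ≤ K * A.card → W.card ≤ K * B.card →
        ∃ x ∈ A, ∃ y ∈ B, (x, y) ∈ E)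
    (hU : U.Nonempty) (hW : W.Nonempty) (f : V → ℕ) (ℓ : ℕ) (hf : ∀ v, f v < ℓ)
    (hfE : ∀ u v, (u, v) ∈ E → u ∉ S → v ∉ S → f u < f v) :
    ∃ a ≤ ℓ, K * (U.filter (fun u => u ∉ S ∧ a ≤ f u)).card < U.card ∧
      K * (W.filter (fun v => v ∉ S ∧ f v < a)).card < W.card := by
  classical
  have hex : ∃ a, K * (U.filter (fun u => u ∉ S ∧ a ≤ f u)).card < U.card := by
    refine ⟨ℓ, ?_⟩
    rw [Finset.filter_false_of_mem fun u _ => by have := hf u; omega]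
    simpa using hU
  -- Take the least `a` above which `U` is sparse. At `a - 1` it is still dense, so a dense part of
  -- `W` below `a` would receive an edge from rank at least `a - 1` to rank below `a`.
  refine ⟨Nat.find hex, ?_, Nat.find_spec hex, ?_⟩
  · refine Nat.find_min' hex ?_
    rw [Finset.filter_false_of_mem fun u _ => by have := hf u; omega]
    simpa using hU
  · rcases Nat.eq_zero_or_pos (Nat.find hex) with h0 | h0
    · rw [h0, Finset.filter_false_of_mem fun u _ => by omega]
      simpa using hW
    · have hmin := Nat.find_min hex (m := Nat.find hex - 1) (by omega)
      by_contra! hcon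
      obtain ⟨x, hx, y, hy, hxy⟩ := hE _ (Finset.filter_subset _ _) _ (Finset.filter_subset _ _)
        (not_lt.1 hmin) hcon
      rw [Finset.mem_filter] at hx hy
      have := hfE x y hxy hx.2.1 hy.2.1
      omega

/-- If `b` is mostly larger on the points marked `false` than on those marked `true`, then a single
threshold predicts the marks up to few errors. -/
theorem exists_cut {J : Type*} [Fintype J] [DecidableEq J] (i : J → Bool) (b : J → ℕ) (ℓ τ : ℕ)
    (hb : ∀ j, b j ≤ ℓ)
    (h : 4 * ((Finset.univ : Finset (J × J)).filter
      (fun p => i p.1 = true ∧ i p.2 = false ∧ b p.2 ≤ b p.1)).card ≤ τ ^ 2) :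
    ∃ θ ≤ ℓ + 1, (Finset.univ.filter (fun j => i j ≠ decide (b j < θ))).card ≤ τ := by
  let Z : ℕ → Finset J := fun θ => Finset.univ.filter (fun j => i j = false ∧ b j < θ)
  let W : ℕ → Finset J := fun θ => Finset.univ.filter (fun j => i j = true ∧ θ ≤ b j)
  have hsplit : ∀ θ, (Finset.univ.filter (fun j => i j ≠ decide (b j < θ))) ⊆ Z θ ∪ W θ := by
    intro θ j hj
    simp only [Finset.mem_filter, Finset.mem_univ, true_and] at hj
    simp only [Z, W, Finset.mem_union, Finset.mem_filter, Finset.mem_univ, true_and]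
    cases hij : i j
    · left; rw [hij] at hj; simpa using hj
    · right; rw [hij] at hj; simpa using hj
  suffices ∃ θ ≤ ℓ + 1, 2 * (Z θ).card ≤ τ ∧ 2 * (W θ).card ≤ τ by
    obtain ⟨θ, hθ, h1, h2⟩ := this
    refine ⟨θ, hθ, (Finset.card_le_card (hsplit θ)).trans ?_⟩
    have := Finset.card_union_le (Z θ) (W θ)
    omega
  let P : ℕ → Prop := fun θ => 2 * (Z θ).card ≤ τ
  have hP0 : P 0 := by simp [P, Z]
  -- Push the cut up while at most `τ / 2` of the `false` points lie below it. If more than `τ / 2`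
  -- of the `true` points lay above, pairing them with the `false` points below `θ + 1` would give
  -- more than `τ ^ 2 / 4` inversions.
  set θ := Nat.findGreatest P (ℓ + 1) with hθ
  have hPθ : P θ := Nat.findGreatest_spec (P := P) (Nat.zero_le _) hP0
  refine ⟨θ, Nat.findGreatest_le _, hPθ, ?_⟩
  rcases (Nat.findGreatest_le (P := P) (ℓ + 1)).eq_or_lt with heq | hlt
  · have : W θ = ∅ := by
      ext j
      have := hb j
      simp only [W, Finset.mem_filter, Finset.mem_univ, true_and, Finset.notMem_empty, iff_false]
      omega
    simp [this]
  · have hnot : ¬ P (θ + 1) := Nat.findGreatest_is_greatest (P := P) (n := ℓ + 1) (by omega) hlt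
    have hsub : (W θ) ×ˢ (Z (θ + 1)) ⊆ (Finset.univ : Finset (J × J)).filter
      (fun p => i p.1 = true ∧ i p.2 = false ∧ b p.2 ≤ b p.1) := by
      rintro ⟨x, y⟩ hp
      simp only [Finset.mem_product, W, Z, Finset.mem_filter, Finset.mem_univ, true_and] at hp ⊢
      exact ⟨hp.1.1, hp.2.1, by omega⟩
    have hc := Finset.card_le_card hsub
    rw [Finset.card_product] at hc
    by_contra! hcon
    have h1 : τ < 2 * (Z (θ + 1)).card := not_le.1 hnot
    have : τ * τ < (2 * (W θ).card) * (2 * (Z (θ + 1)).card) := Nat.mul_lt_mul'' hcon h1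
    nlinarith

/-- Weight the elements outside a set by 16: the total weight is `17 ^ (32 * τ)`, each small set
weighs at least `16 ^ (31 * τ)`, and `17 ^ 32 ≤ 2 ^ 131 = 2 ^ 7 * 16 ^ 31`. -/
theorem card_subsets_le (τ : ℕ) :
    ((Finset.univ : Finset (Finset (Fin (32 * τ)))).filter (fun s => s.card ≤ τ)).card
      ≤ 2 ^ (7 * τ) := by
  set F := (Finset.univ : Finset (Finset (Fin (32 * τ)))).filter (fun s => s.card ≤ τ)
  have h1 : ∑ s : Finset (Fin (32 * τ)), 1 ^ s.card * 16 ^ (32 * τ - s.card) = (1 + 16) ^ (32 * τ) := by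
    have := Fintype.sum_pow_mul_eq_add_pow (Fin (32 * τ)) (1 : ℕ) 16
    simpa using this
  have h2 : F.card * 16 ^ (31 * τ) ≤ (1 + 16) ^ (32 * τ) := by
    rw [← h1, ← smul_eq_mul]
    refine (Finset.card_nsmul_le_sum F (fun s => 1 ^ s.card * 16 ^ (32 * τ - s.card)) _ ?_).trans
      (Finset.sum_le_sum_of_subset (Finset.subset_univ _))
    intro s hs
    have hs' : s.card ≤ τ := (Finset.mem_filter.1 hs).2
    rw [one_pow, one_mul]
    exact Nat.pow_le_pow_right (by norm_num) (by omega)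
  have h3 : (1 + 16 : ℕ) ^ (32 * τ) ≤ 2 ^ (7 * τ) * 16 ^ (31 * τ) := by
    calc (1 + 16 : ℕ) ^ (32 * τ) = (17 ^ 32) ^ τ := by rw [← pow_mul]
      _ ≤ (2 ^ 131) ^ τ := Nat.pow_le_pow_left (by norm_num) _
      _ = 2 ^ (7 * τ) * 16 ^ (31 * τ) := by
        rw [show (16 : ℕ) = 2 ^ 4 by norm_num, ← pow_mul, ← pow_mul, ← pow_add]; congr 1; ring
  exact Nat.le_of_mul_le_mul_right (h2.trans h3) (by positivity)

/-! ### A sparse depth-robust graph from a binary tree -/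

/-- Vertices of the depth-robust graph: a leaf of the binary tree of depth `t`, the scale of the
edges entering the vertex and the scale of the edges leaving it. -/
abbrev ScaleVertex (t : ℕ) : Type := (Fin t → Bool) × Fin t × Fin t

/-- Internal nodes of the binary tree of depth `t`. -/
abbrev TreeNode (t : ℕ) : Type := Σ j : Fin t, ({k : Fin t // k < j} → Bool)

/-- The node at depth `j` on the branch to the leaf `i`. -/
def treeNode {t : ℕ} (i : Fin t → Bool) (j : Fin t) : TreeNode t := ⟨j, fun k => i k.1⟩

/-- The vertices below the left child of `b` whose leaving edges have the scale of `b`. -/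
def outBlock {t : ℕ} (b : TreeNode t) : Finset (ScaleVertex t) :=
  Finset.univ.filter (fun v => treeNode v.1 v.2.2 = b ∧ v.1 v.2.2 = false)

/-- The vertices below the right child of `b` whose entering edges have the scale of `b`. -/
def inBlock {t : ℕ} (b : TreeNode t) : Finset (ScaleVertex t) :=
  Finset.univ.filter (fun v => treeNode v.1 v.2.1 = b ∧ v.1 v.2.1 = true)

theorem exists_leaf {t : ℕ} (b : TreeNode t) (c : Bool) :
    ∃ i : Fin t → Bool, treeNode i b.1 = b ∧ i b.1 = c := by
  obtain ⟨j, p⟩ := b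
  refine ⟨fun k => if h : k < j then p ⟨k, h⟩ else c, ?_, by simp⟩
  simp only [treeNode]
  congr 1
  funext k
  simp [k.2]

theorem outBlock_nonempty {t : ℕ} (b : TreeNode t) : (outBlock b).Nonempty := by
  obtain ⟨i, h1, h2⟩ := exists_leaf b false
  exact ⟨(i, b.1, b.1), by simp [outBlock, h1, h2]⟩

theorem inBlock_nonempty {t : ℕ} (b : TreeNode t) : (inBlock b).Nonempty := by
  obtain ⟨i, h1, h2⟩ := exists_leaf b true
  exact ⟨(i, b.1, b.1), by simp [inBlock, h1, h2]⟩

theorem sum_card_fiber_le {V β : Type*} [Fintype V] [Fintype β] [DecidableEq β] (key : V → β)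
    (P : V → Prop) [DecidablePred P] :
    ∑ b, (Finset.univ.filter (fun v => key v = b ∧ P v)).card ≤ Fintype.card V := by
  have h := Finset.card_eq_sum_card_fiberwise (f := key) (s := Finset.univ.filter P)
    (t := Finset.univ) (fun _ _ => Finset.mem_coe.2 (Finset.mem_univ _))
  have h' : ∀ b, (Finset.univ.filter (fun v => key v = b ∧ P v))
      = (Finset.univ.filter P).filter (fun v => key v = b) := by
    intro b; ext v; simp [and_comm]
  simp only [h']
  rw [← h]
  exact Finset.card_le_univ _

theorem mul_card_le_of_fiberwise {V β : Type*} [Fintype V] [Fintype β] [DecidableEq β] (K : ℕ)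
    (key : V → β) (P R : V → Prop) [DecidablePred P] [DecidablePred R]
    (h : ∀ b, K * (Finset.univ.filter (fun v => key v = b ∧ R v)).card ≤
      (Finset.univ.filter (fun v => key v = b ∧ P v)).card) :
    K * (Finset.univ.filter R).card ≤ Fintype.card V := by
  have h1 := Finset.card_eq_sum_card_fiberwise (f := key) (s := Finset.univ.filter R)
    (t := Finset.univ) (fun _ _ => Finset.mem_coe.2 (Finset.mem_univ _))
  have h' : ∀ b, (Finset.univ.filter (fun v => key v = b ∧ R v))
      = (Finset.univ.filter R).filter (fun v => key v = b) := by
    intro b; ext v; simp [and_comm]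
  rw [h1, Finset.mul_sum]
  refine (Finset.sum_le_sum fun b _ => ?_).trans (sum_card_fiber_le key P)
  rw [← h']
  exact h b

/-- The branch to a leaf is determined by the set of places where a rule predicting the next turn
from the current node is wrong. -/
theorem leaf_eq_of_errors_eq {t : ℕ} (g : TreeNode t → Bool) {i i' : Fin t → Bool}
    (h : Finset.univ.filter (fun j => i j ≠ g (treeNode i j))
      = Finset.univ.filter (fun j => i' j ≠ g (treeNode i' j))) : i = i' := by
  funext j
  induction j using WellFoundedLT.induction with
  | ind j ih =>
    have hn : treeNode i j = treeNode i' j := by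
      simp only [treeNode]
      congr 1
      funext k
      exact ih k.1 k.2
    have hj := congrArg (fun s => j ∈ s) h
    simp only [Finset.mem_filter, Finset.mem_univ, true_and, eq_iff_iff, hn] at hj
    revert hj
    cases i j <;> cases i' j <;> cases g (treeNode i' j) <;> simp

/-- If every leaf in `G` is predicted up to `τ` errors by one of few rules, then `G` is small. -/
theorem card_leaves_le {t τ : ℕ} (ht : t = 32 * τ) (m : ℕ) (g : ℕ → TreeNode t → Bool)
    (G : Finset (Fin t → Bool))
    (hG : ∀ i ∈ G, ∃ θ ≤ m,
      (Finset.univ.filter (fun j => i j ≠ g θ (treeNode i j))).card ≤ τ) :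
    G.card ≤ (m + 1) * 2 ^ (7 * τ) := by
  classical
  subst ht
  choose! θ hθ hθ' using hG
  let F : (Fin (32 * τ) → Bool) → ℕ × Finset (Fin (32 * τ)) := fun i =>
    (θ i, Finset.univ.filter (fun j => i j ≠ g (θ i) (treeNode i j)))
  have hmaps : ∀ i ∈ G, F i ∈ Finset.range (m + 1) ×ˢ
      ((Finset.univ : Finset (Finset (Fin (32 * τ)))).filter (fun s => s.card ≤ τ)) := by
    intro i hi
    simp only [F, Finset.mem_product, Finset.mem_range, Finset.mem_filter, Finset.mem_univ,
      true_and]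
    exact ⟨Nat.lt_succ_of_le (hθ i hi), hθ' i hi⟩
  have hinj : Set.InjOn F G := by
    intro i hi i' hi' h
    have h1 : θ i = θ i' := congrArg Prod.fst h
    have h2 := congrArg Prod.snd h
    simp only [F, h1] at h2
    exact leaf_eq_of_errors_eq (g (θ i')) h2
  refine (Finset.card_le_card_of_injOn F hmaps hinj).trans ?_
  rw [Finset.card_product, Finset.card_range]
  exact Nat.mul_le_mul_left _ (card_subsets_le τ)

theorem card_scaleVertex (t : ℕ) : Fintype.card (ScaleVertex t) = 2 ^ t * t ^ 2 := by
  simp [sq]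

/-- A graph with dispersers between the two blocks of every tree node has long walks outside every
small set of vertices. -/
theorem exists_walk_of_disperser_blocks {t τ : ℕ} (ht : t = 32 * τ) (hτ : 1 ≤ τ)
    (E : Finset (ScaleVertex t × ScaleVertex t))
    (hE : ∀ b, ∀ A ⊆ outBlock b, ∀ B ⊆ inBlock b, (outBlock b).card ≤ 2 ^ 20 * A.card →
      (inBlock b).card ≤ 2 ^ 20 * B.card → ∃ x ∈ A, ∃ y ∈ B, (x, y) ∈ E)
    (S : Finset (ScaleVertex t))
    (hS : 2 ^ 14 * S.card ≤ Fintype.card (ScaleVertex t)) :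
    ∃ u v, Walk (fun u v => (u, v) ∈ E ∧ u ∉ S ∧ v ∉ S) (2 ^ (20 * τ)) u v := by
  classical
  by_contra! hcon
  set ℓ := 2 ^ (20 * τ) with hℓ
  obtain ⟨f, hfℓ, hf⟩ := exists_rank_of_forall_not_walk _ ℓ hcon
  have hthr : ∀ b : TreeNode t, ∃ a ≤ ℓ,
      2 ^ 20 * ((outBlock b).filter (fun u => u ∉ S ∧ a ≤ f u)).card < (outBlock b).card ∧
      2 ^ 20 * ((inBlock b).filter (fun v => v ∉ S ∧ f v < a)).card < (inBlock b).card :=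
    fun b => exists_threshold (hE b) (outBlock_nonempty b) (inBlock_nonempty b) f ℓ hfℓ
      fun u v huv hu hv => hf u v ⟨huv, hu, hv⟩
  choose a haℓ haO haI using hthr
  -- `B₁` and `B₂` hold the surviving vertices on the wrong side of the threshold of the node at
  -- their leaving or entering scale. Blocks of different nodes are disjoint, so the blockwise
  -- bounds add up.
  let B₁ : Finset (ScaleVertex t) := Finset.univ.filter
    (fun v => v.1 v.2.2 = false ∧ v ∉ S ∧ a (treeNode v.1 v.2.2) ≤ f v)
  let B₂ : Finset (ScaleVertex t) := Finset.univ.filter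
    (fun v => v.1 v.2.1 = true ∧ v ∉ S ∧ f v < a (treeNode v.1 v.2.1))
  have hB₁ : 2 ^ 20 * B₁.card ≤ Fintype.card (ScaleVertex t) := by
    refine mul_card_le_of_fiberwise (2 ^ 20) (fun v : ScaleVertex t => treeNode v.1 v.2.2)
      (fun v => v.1 v.2.2 = false) _ fun b => ?_
    refine le_trans (le_of_eq ?_) (haO b).le
    congr 2
    ext v
    simp only [outBlock, Finset.mem_filter, Finset.mem_univ, true_and]
    constructor
    · rintro ⟨rfl, h1, h2, h3⟩; exact ⟨⟨rfl, h1⟩, h2, h3⟩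
    · rintro ⟨⟨rfl, h1⟩, h2, h3⟩; exact ⟨rfl, h1, h2, h3⟩
  have hB₂ : 2 ^ 20 * B₂.card ≤ Fintype.card (ScaleVertex t) := by
    refine mul_card_le_of_fiberwise (2 ^ 20) (fun v : ScaleVertex t => treeNode v.1 v.2.1)
      (fun v => v.1 v.2.1 = true) _ fun b => ?_
    refine le_trans (le_of_eq ?_) (haI b).le
    congr 2
    ext v
    simp only [inBlock, Finset.mem_filter, Finset.mem_univ, true_and]
    constructor
    · rintro ⟨rfl, h1, h2, h3⟩; exact ⟨⟨rfl, h1⟩, h2, h3⟩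
    · rintro ⟨⟨rfl, h1⟩, h2, h3⟩; exact ⟨rfl, h1, h2, h3⟩
  let Bad := S ∪ B₁ ∪ B₂
  have hBad : 2 ^ 13 * Bad.card ≤ 2 ^ t * t ^ 2 := by
    rw [card_scaleVertex] at hB₁ hB₂ hS
    have h1 : Bad.card ≤ S.card + B₁.card + B₂.card :=
      (Finset.card_union_le _ _).trans (Nat.add_le_add_right (Finset.card_union_le _ _) _)
    omega
  let bd : (Fin t → Bool) → Finset (Fin t × Fin t) := fun i =>
    Finset.univ.filter (fun p => (i, p) ∈ Bad)
  have hbd : ∑ i, (bd i).card = Bad.card := by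
    rw [Finset.card_eq_sum_card_fiberwise (f := Prod.fst) (s := Bad) (t := Finset.univ)
      (fun _ _ => Finset.mem_coe.2 (Finset.mem_univ _))]
    refine Finset.sum_congr rfl fun i _ => ?_
    refine Finset.card_bij (fun p _ => (i, p)) ?_ ?_ ?_
    · intro p hp
      simpa [bd] using hp
    · intro p _ p' _ h
      exact congrArg Prod.snd h
    · rintro ⟨i', p⟩ hv
      rw [Finset.mem_filter] at hv
      obtain ⟨hv, rfl⟩ := hv
      exact ⟨p, by simpa [bd] using hv, rfl⟩
  -- By Markov's inequality at least half of the leaves carry a proportion at most `2 ^ (-12)` of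
  -- bad scale pairs.
  let G : Finset (Fin t → Bool) := Finset.univ.filter (fun i => 2 ^ 12 * (bd i).card ≤ t ^ 2)
  have ht0 : 0 < t ^ 2 := by
    have : 0 < t := by omega
    positivity
  have hG : 2 ^ t ≤ 2 * G.card := by
    have h1 : Gᶜ.card * t ^ 2 ≤ 2 ^ 12 * Bad.card := by
      rw [← hbd, Finset.mul_sum, ← smul_eq_mul]
      refine (Finset.card_nsmul_le_sum Gᶜ (fun i => 2 ^ 12 * (bd i).card) _ ?_).trans
        (Finset.sum_le_sum_of_subset (Finset.subset_univ _))
      intro i hi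
      simp only [G, Finset.mem_compl, Finset.mem_filter, Finset.mem_univ, true_and, not_le] at hi
      exact hi.le
    have h2 : (2 * Gᶜ.card) * t ^ 2 ≤ 2 ^ t * t ^ 2 := by
      calc (2 * Gᶜ.card) * t ^ 2 = 2 * (Gᶜ.card * t ^ 2) := by ring
        _ ≤ 2 * (2 ^ 12 * Bad.card) := Nat.mul_le_mul_left _ h1
        _ = 2 ^ 13 * Bad.card := by ring
        _ ≤ _ := hBad
    have h3 := Nat.le_of_mul_le_mul_right h2 ht0
    have h4 := Finset.card_add_card_compl G
    have h5 : Fintype.card (Fin t → Bool) = 2 ^ t := by simp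
    omega
  have hcut : ∀ i ∈ G, ∃ θ ≤ ℓ + 1,
      (Finset.univ.filter (fun j => i j ≠ decide (a (treeNode i j) < θ))).card ≤ τ := by
    intro i hi
    refine exists_cut i (fun j => a (treeNode i j)) ℓ τ (fun j => haℓ _) ?_
    have hi' : 2 ^ 12 * (bd i).card ≤ t ^ 2 := by simpa [G] using hi
    have hsub : ((Finset.univ : Finset (Fin t × Fin t)).filter (fun p => i p.1 = true ∧
        i p.2 = false ∧ a (treeNode i p.2) ≤ a (treeNode i p.1))) ⊆ bd i := by
      rintro ⟨p, p'⟩ hp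
      simp only [Finset.mem_filter, Finset.mem_univ, true_and] at hp
      simp only [bd, Bad, B₁, B₂, Finset.mem_filter, Finset.mem_univ, true_and, Finset.mem_union]
      -- A vertex `(i, p, p')` that is not bad enters from the left at scale `p` and leaves to the
      -- right at `p'`, so its rank is at least the threshold at `p` and below the threshold at
      -- `p'`. Every inversion of the thresholds is therefore a bad pair.
      by_cases h1 : ((i, p, p') : ScaleVertex t) ∈ S
      · exact Or.inl (Or.inl h1)
      · rcases le_or_gt (a (treeNode i p')) (f (i, p, p')) with h2 | h2
        · exact Or.inl (Or.inr ⟨hp.2.1, h1, h2⟩)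
        · exact Or.inr ⟨hp.1, h1, h2.trans_le hp.2.2⟩
    have hc := Finset.card_le_card hsub
    -- With `t = 32 * τ` the proportion `2 ^ (-12)` of `t ^ 2` is exactly the `τ ^ 2 / 4` inversions
    -- allowed by `exists_cut`.
    have ht2 : t ^ 2 = 2 ^ 10 * τ ^ 2 := by rw [ht]; ring
    omega
  have hfin := card_leaves_le ht (ℓ + 1) (fun θ b => decide (a b < θ)) G hcut
  have h1 : (ℓ + 1 + 1) * 2 ^ (7 * τ) ≤ 2 ^ (27 * τ + 1) := by
    have h2 : 2 ≤ ℓ := by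
      rw [hℓ]
      calc 2 = 2 ^ 1 := rfl
        _ ≤ 2 ^ (20 * τ) := Nat.pow_le_pow_right (by norm_num) (by omega)
    calc (ℓ + 1 + 1) * 2 ^ (7 * τ) ≤ (2 * ℓ) * 2 ^ (7 * τ) := Nat.mul_le_mul_right _ (by omega)
      _ = 2 ^ (27 * τ + 1) := by rw [hℓ, pow_succ, mul_assoc, ← pow_add, mul_comm]; congr 2; ring
  have h2 : 2 ^ t ≤ 2 ^ (27 * τ + 2) := by
    calc 2 ^ t ≤ 2 * G.card := hG
      _ ≤ 2 * 2 ^ (27 * τ + 1) := Nat.mul_le_mul_left _ (hfin.trans h1)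
      _ = 2 ^ (27 * τ + 2) := by ring
  -- A cut costs `20 * τ` bits and an error set `7 * τ`, so `32 * τ ≤ 27 * τ + 2`, which is false
  -- for `τ ≥ 1`.
  have h3 := (Nat.pow_le_pow_iff_right (by norm_num : 1 < 2)).1 h2
  omega

/-- Finite graphs whose edges increase in a linear order have a ranking by natural numbers. -/
theorem exists_nat_rank {V α : Type*} [Finite α] [LinearOrder α] (r : V → V → Prop) (f : V → α)
    (h : ∀ u v, r u v → f u < f v) : ∃ g : V → ℕ, ∀ u v, r u v → g u < g v := by
  classical
  have := Fintype.ofFinite α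
  refine ⟨fun v => (Finset.univ.filter (fun x => x < f v)).card, fun u v huv => ?_⟩
  refine Finset.card_lt_card ?_
  rw [Finset.ssubset_iff_of_subset]
  · exact ⟨f u, by simpa using h u v huv, by simp⟩
  · intro x hx
    simp only [Finset.mem_filter, Finset.mem_univ, true_and] at hx ⊢
    exact hx.trans (h u v huv)

/-- Sparse acyclic graphs with long walks outside every small set of vertices. -/
theorem exists_depthRobust : ∃ δ : ℕ, ∀ τ : ℕ, 1 ≤ τ →
    ∃ E : Finset (ScaleVertex (32 * τ) × ScaleVertex (32 * τ)),
      E.card ≤ δ * Fintype.card (ScaleVertex (32 * τ)) ∧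
      (∃ rank : ScaleVertex (32 * τ) → ℕ, ∀ u v, (u, v) ∈ E → rank u < rank v) ∧
      ∀ S : Finset (ScaleVertex (32 * τ)),
        2 ^ 14 * S.card ≤ Fintype.card (ScaleVertex (32 * τ)) →
        ∃ u v, Walk (fun u v => (u, v) ∈ E ∧ u ∉ S ∧ v ∉ S) (2 ^ (20 * τ)) u v := by
  classical
  obtain ⟨δ, hδ⟩ := exists_disperser_finset (2 ^ 20) (by norm_num)
  refine ⟨2 * δ, fun τ hτ => ?_⟩
  choose Q hQ hQs hQd using fun b : TreeNode (32 * τ) =>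
    hδ (ScaleVertex (32 * τ)) (outBlock b) (inBlock b) (outBlock_nonempty b) (inBlock_nonempty b)
  refine ⟨Finset.univ.biUnion Q, ?_, ?_, fun S hS => exists_walk_of_disperser_blocks rfl hτ _ ?_ S hS⟩
  · refine Finset.card_biUnion_le.trans ((Finset.sum_le_sum fun b _ => hQ b).trans ?_)
    -- The two scales place each vertex in at most one block of either kind, which keeps the average
    -- degree bounded although the tree has many levels.
    rw [← Finset.mul_sum, Finset.sum_add_distrib]
    have h1 : ∑ b, (outBlock b).card ≤ Fintype.card (ScaleVertex (32 * τ)) :=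
      sum_card_fiber_le _ _
    have h2 : ∑ b, (inBlock b).card ≤ Fintype.card (ScaleVertex (32 * τ)) :=
      sum_card_fiber_le _ _
    calc _ ≤ δ * (2 * Fintype.card (ScaleVertex (32 * τ))) := Nat.mul_le_mul_left _ (by omega)
      _ = _ := by ring
  -- Edges lead from the left to the right subtree of a node, so the leaf increases
  -- lexicographically.
  · refine exists_nat_rank _ (fun v => toLex v.1) fun u v huv => ?_
    obtain ⟨b, -, hb⟩ := Finset.mem_biUnion.1 huv
    obtain ⟨h1, h2⟩ := hQs b _ hb
    simp only [outBlock, inBlock, Finset.mem_filter, Finset.mem_univ, true_and] at h1 h2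
    obtain ⟨hu, hu'⟩ := h1
    obtain ⟨hv, hv'⟩ := h2
    subst hu
    simp only [treeNode, Sigma.mk.injEq] at hv
    obtain ⟨hj, hp⟩ := hv
    refine ⟨u.2.2, fun k hk => ?_, ?_⟩
    · obtain ⟨u1, u2, u3⟩ := u
      obtain ⟨v1, v2, v3⟩ := v
      simp only at hj hk hp ⊢
      subst hj
      exact (congrFun (eq_of_heq hp) ⟨k, hk⟩).symm
    · rw [← hj]
      have : u.1 v.2.1 = false := by rw [hj]; exact hu'
      show u.1 v.2.1 < v.1 v.2.1
      rw [this, hv']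
      exact Bool.false_lt_true
  · intro b A hA B hB h1 h2
    obtain ⟨x, hx, y, hy, hxy⟩ := hQd b A hA B hB h1 h2
    exact ⟨x, hx, y, hy, Finset.mem_biUnion.2 ⟨b, Finset.mem_univ _, hxy⟩⟩

/-! ### Many long walks with distinct ends -/

theorem Walk.exists_first {V : Type*} {r : V → V → Prop} {n : ℕ} {u v : V} (h : Walk r n u v)
    (hn : 1 ≤ n) : ∃ w, r u w := by
  obtain _ | n := n
  · omega
  · obtain ⟨w, hw, -⟩ := h
    exact ⟨w, hw⟩

theorem Walk.exists_last {V : Type*} {r : V → V → Prop} {n : ℕ} {u v : V} (h : Walk r n u v)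
    (hn : 1 ≤ n) : ∃ w, r w v :=
  h.flip.exists_first hn

/-- A graph with long walks outside every small set has many of them with distinct starting points
and distinct end points. -/
theorem exists_walk_matching {V : Type} [Fintype V] [DecidableEq V] {E : Finset (V × V)} {ℓ : ℕ}
    (hℓ : 1 ≤ ℓ)
    (hE : ∀ S : Finset V, 2 ^ 14 * S.card ≤ Fintype.card V →
      ∃ u v, Walk (fun u v => (u, v) ∈ E ∧ u ∉ S ∧ v ∉ S) ℓ u v)
    {S : Finset V} (hS : 2 ^ 15 * S.card ≤ Fintype.card V) (m : ℕ)
    (hm : 2 ^ 16 * m ≤ Fintype.card V) :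
    ∃ P : Finset (V × V), P.card = m ∧ Set.InjOn Prod.fst (P : Set (V × V)) ∧
      Set.InjOn Prod.snd (P : Set (V × V)) ∧
      ∀ p ∈ P, Walk (fun u v => (u, v) ∈ E ∧ u ∉ S ∧ v ∉ S) ℓ p.1 p.2 := by
  induction m with
  | zero => exact ⟨∅, by simp⟩
  | succ m ih =>
    obtain ⟨P, hPc, hP1, hP2, hP⟩ := ih (by omega)
    -- The ends already used are deleted along with `S`; at most `2 ^ (-15)` of the vertices for `S`
    -- and as much again for the ends stays within the allowed `2 ^ (-14)`.
    obtain ⟨u, v, huv⟩ := hE (S ∪ P.image Prod.fst ∪ P.image Prod.snd) (by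
      have h1 := Finset.card_union_le (S ∪ P.image Prod.fst) (P.image Prod.snd)
      have h2 := Finset.card_union_le S (P.image Prod.fst)
      have h3 : (P.image Prod.fst).card ≤ P.card := Finset.card_image_le
      have h4 : (P.image Prod.snd).card ≤ P.card := Finset.card_image_le
      omega)
    obtain ⟨w, -, hu, -⟩ := huv.exists_first hℓ
    obtain ⟨w', -, -, hv⟩ := huv.exists_last hℓ
    simp only [Finset.mem_union, not_or, Finset.mem_image, not_exists, not_and] at hu hv
    have hnot : (u, v) ∉ P := fun h => hu.1.2 _ h rfl
    refine ⟨insert (u, v) P, by rw [Finset.card_insert_of_notMem hnot, hPc], ?_, ?_, ?_⟩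
    · rw [Finset.coe_insert, Set.injOn_insert (by simpa using hnot)]
      refine ⟨hP1, ?_⟩
      rintro ⟨x, hx, hxu⟩
      exact hu.1.2 x hx hxu
    · rw [Finset.coe_insert, Set.injOn_insert (by simpa using hnot)]
      refine ⟨hP2, ?_⟩
      rintro ⟨x, hx, hxv⟩
      exact hv.2 x hx hxv
    · intro p hp
      rcases Finset.mem_insert.1 hp with rfl | hp
      · refine huv.mono fun x y hxy => ⟨hxy.1, fun hx => hxy.2.1 ?_, fun hy => hxy.2.2 ?_⟩ <;>
          simp [*]
      · exact hP p hp

/-! ### Reachability along a walk of levels -/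

section Levels

variable {V R W : Type} [Fintype W] [DecidableEq W] {K : ℕ} {ρ : V → V → Prop} {r : R → R → Prop}
  {Q : Finset (W × W)} {e : R → W → V} {alive : R → W → Prop}

open Classical in
/-- The points of level `j` that are dead or not reached from `A`. -/
noncomputable def unreached (ρ : V → V → Prop) (e : R → W → V) (alive : R → W → Prop)
    (A : Finset V) (j : R) : Finset W :=
  Finset.univ.filter (fun y => ¬ (alive j y ∧ ∃ v ∈ A, ReflTransGen ρ v (e j y)))

open Classical in
/-- The dead points of level `j`. -/
noncomputable def dead (alive : R → W → Prop) (j : R) : Finset W :=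
  Finset.univ.filter (fun y => ¬ alive j y)

/-- Once a `1 / K` fraction of a level is reached, a point of the next level is missed only if it is
dead or has no neighbour in the reached part; each kind makes up at most a `1 / K` fraction. -/
theorem card_unreached_step (hQ : IsDisperser K Q)
    (hstep : ∀ i i' x x', r i i' → (x, x') ∈ Q → alive i x → alive i' x' → ρ (e i x) (e i' x'))
    (hgood : ∀ i i', r i i' → K * (dead alive i').card ≤ Fintype.card W) {A : Finset V} {j j' : R}
    (hj : r j j') (hA : Fintype.card W ≤ K * (unreached ρ e alive A j)ᶜ.card) :
    K * (unreached ρ e alive A j').card ≤ 2 * Fintype.card W := by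
  classical
  let N : Finset W := Finset.univ.filter
    (fun y => ∀ x ∈ (unreached ρ e alive A j)ᶜ, (x, y) ∉ Q)
  have h1 : K * N.card < Fintype.card W := hQ.card_lt_of_forall_notMem hA fun x hx y hy =>
    (Finset.mem_filter.1 hy).2 x hx
  have h2 : unreached ρ e alive A j' ⊆ N ∪ dead alive j' := by
    intro y hy
    by_contra hcon
    simp only [N, dead, Finset.mem_union, Finset.mem_filter, Finset.mem_univ, true_and,
      not_or, not_not, not_forall] at hcon
    obtain ⟨⟨x, hx, hxy⟩, hal⟩ := hcon
    simp only [unreached, Finset.mem_compl, Finset.mem_filter, Finset.mem_univ, true_and,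
      not_not] at hx hy
    obtain ⟨hxa, v, hv, hvx⟩ := hx
    exact hy ⟨hal, v, hv, hvx.tail (hstep _ _ _ _ hj hxy hxa hal)⟩
  have h3 := (Finset.card_le_card h2).trans (Finset.card_union_le _ _)
  have h4 := hgood j j' hj
  nlinarith

theorem compl_unreached_subset_union [DecidableEq V] {A A₁ A₂ : Finset V} (hA : A ⊆ A₁ ∪ A₂)
    (j : R) : (unreached ρ e alive A j)ᶜ ⊆
      (unreached ρ e alive A₁ j)ᶜ ∪ (unreached ρ e alive A₂ j)ᶜ := by
  intro y hy
  simp only [unreached, Finset.mem_union, Finset.mem_compl, Finset.mem_filter, Finset.mem_univ,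
    true_and, not_not] at hy ⊢
  obtain ⟨hy, v, hv, hvy⟩ := hy
  rcases Finset.mem_union.1 (hA hv) with h | h
  · exact Or.inl ⟨hy, v, h, hvy⟩
  · exact Or.inr ⟨hy, v, h, hvy⟩

/-- Repeated halving: along a walk of `m + 1` levels, one of at most `2 ^ m` vertices that jointly
reach a dense part of the first level reaches almost all of the last level. -/
theorem exists_single_reaching (hK : 4 ≤ K) (hQ : IsDisperser K Q)
    (hstep : ∀ i i' x x', r i i' → (x, x') ∈ Q → alive i x → alive i' x' → ρ (e i x) (e i' x'))
    (hgood : ∀ i i', r i i' → K * (dead alive i').card ≤ Fintype.card W) (hW : 0 < Fintype.card W)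
    {h : R} (m : ℕ) {A : Finset V} {j : R} (hAm : A.card ≤ 2 ^ m)
    (hA : Fintype.card W ≤ K * (unreached ρ e alive A j)ᶜ.card) (hwalk : Walk r (m + 1) j h) :
    ∃ v ∈ A, K * (unreached ρ e alive {v} h).card ≤ 2 * Fintype.card W := by
  classical
  induction m generalizing A j with
  | zero =>
    obtain ⟨j', hj, hj'⟩ := hwalk
    cases hj'
    have hne : A.Nonempty := by
      by_contra hcon
      rw [Finset.not_nonempty_iff_eq_empty] at hcon
      have : (unreached ρ e alive A j)ᶜ = ∅ := by
        ext y; simp [unreached, hcon]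
      rw [this] at hA
      simp at hA
      omega
    obtain ⟨v, hv⟩ := Finset.card_eq_one.1 (le_antisymm (by simpa using hAm) hne.card_pos)
    refine ⟨v, by simp [hv], ?_⟩
    rw [← hv]
    exact card_unreached_step hQ hstep hgood hj hA
  | succ m ih =>
    obtain ⟨j', hj, hj'⟩ := hwalk
    have h1 := card_unreached_step hQ hstep hgood hj hA
    obtain ⟨A₁, hA₁, hA₁c⟩ := Finset.exists_subset_card_eq (min_le_left A.card (2 ^ m))
    have hA₂ : (A \ A₁).card ≤ 2 ^ m := by
      rw [Finset.card_sdiff_of_subset hA₁, hA₁c]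
      rw [pow_succ] at hAm
      omega
    have hu := (Finset.card_le_card (compl_unreached_subset_union (ρ := ρ) (e := e)
      (alive := alive) (A := A) (A₁ := A₁) (A₂ := A \ A₁) (by simp) j')).trans
      (Finset.card_union_le _ _)
    have hc := Finset.card_add_card_compl (unreached ρ e alive A j')
    -- At least `(1 - 2 / K) * |W|` points are reached jointly, and `4 ≤ K` makes one half of `A`
    -- account for a `1 / K` fraction.
    have hor : Fintype.card W ≤ K * (unreached ρ e alive A₁ j')ᶜ.card ∨
        Fintype.card W ≤ K * (unreached ρ e alive (A \ A₁) j')ᶜ.card := by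
      by_contra! hcon
      nlinarith
    rcases hor with h2 | h2
    · obtain ⟨v, hv, hv'⟩ := ih (by rw [hA₁c]; exact min_le_right _ _) h2 hj'
      exact ⟨v, hA₁ hv, hv'⟩
    · obtain ⟨v, hv, hv'⟩ := ih hA₂ h2 hj'
      exact ⟨v, (Finset.mem_sdiff.1 hv).1, hv'⟩

open Classical in
/-- The points of level `p.1` that are dead or do not reach almost all of level `p.2`. -/
noncomputable def weak (K : ℕ) (ρ : V → V → Prop) (e : R → W → V) (alive : R → W → Prop)
    (p : R × R) : Finset W :=
  Finset.univ.filter (fun x => ¬ (alive p.1 x ∧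
    K * (unreached ρ e alive {e p.1 x} p.2).card ≤ 2 * Fintype.card W))

/-- If the living points that fail to reach almost all of the last level had density at least `1 /
K`, repeated halving of this very set would produce one of them that succeeds. The walk is long
enough because `|W| ≤ 2 ^ m`. -/
theorem card_weak_le (hK : 4 ≤ K) (hQ : IsDisperser K Q)
    (hstep : ∀ i i' x x', r i i' → (x, x') ∈ Q → alive i x → alive i' x' → ρ (e i x) (e i' x'))
    (hgood : ∀ i i', r i i' → K * (dead alive i).card ≤ Fintype.card W ∧
      K * (dead alive i').card ≤ Fintype.card W) (hW : 0 < Fintype.card W)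
    {m : ℕ} (hm : Fintype.card W ≤ 2 ^ m) {p : R × R} (hwalk : Walk r (m + 1) p.1 p.2) :
    K * (weak K ρ e alive p).card ≤ 2 * Fintype.card W := by
  classical
  let X : Finset W := Finset.univ.filter (fun x => alive p.1 x ∧
    ¬ K * (unreached ρ e alive {e p.1 x} p.2).card ≤ 2 * Fintype.card W)
  have hX : K * X.card < Fintype.card W := by
    by_contra! hcon
    have hXm : (X.image (e p.1)).card ≤ 2 ^ m :=
      Finset.card_image_le.trans ((Finset.card_le_univ X).trans hm)
    have hsub : X ⊆ (unreached ρ e alive (X.image (e p.1)) p.1)ᶜ := by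
      intro x hx
      simp only [unreached, Finset.mem_compl, Finset.mem_filter, Finset.mem_univ, true_and, not_not]
      exact ⟨(Finset.mem_filter.1 hx).2.1, e p.1 x, Finset.mem_image_of_mem _ hx, .refl⟩
    obtain ⟨v, hv, hv'⟩ := exists_single_reaching hK hQ hstep (fun i i' h => (hgood i i' h).2) hW m
      hXm (hcon.trans (Nat.mul_le_mul_left _ (Finset.card_le_card hsub))) hwalk
    obtain ⟨x, hx, rfl⟩ := Finset.mem_image.1 hv
    exact (Finset.mem_filter.1 hx).2.2 hv'
  obtain ⟨j, hj⟩ := hwalk.exists_first (by omega)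
  have hd := (hgood _ _ hj).1
  have hsub : weak K ρ e alive p ⊆ dead alive p.1 ∪ X := by
    intro x hx
    simp only [weak, Finset.mem_filter, Finset.mem_univ, true_and, not_and] at hx
    simp only [dead, X, Finset.mem_union, Finset.mem_filter, Finset.mem_univ, true_and]
    by_cases hal : alive p.1 x
    · exact Or.inr ⟨hal, hx hal⟩
    · exact Or.inl hal
  have h3 := (Finset.card_le_card hsub).trans (Finset.card_union_le _ _)
  nlinarith

end Levels

/-! ### Loads of slices and spreading over a transversal -/

theorem sum_card_slice {R Y : Type*} [Fintype R] [Fintype Y] [DecidableEq R] [DecidableEq Y]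
    (T : Finset (R × Y)) :
    ∑ x, (Finset.univ.filter (fun y => (x, y) ∈ T)).card = T.card := by
  rw [Finset.card_eq_sum_card_fiberwise (f := Prod.fst) (s := T) (t := Finset.univ)
    (fun _ _ => Finset.mem_coe.2 (Finset.mem_univ _))]
  refine Finset.sum_congr rfl fun x _ => ?_
  refine Finset.card_bij (fun y _ => (x, y)) ?_ ?_ ?_
  · intro y hy
    simpa using hy
  · intro y _ y' _ h
    exact congrArg Prod.snd h
  · rintro ⟨x', y⟩ hv
    rw [Finset.mem_filter] at hv
    obtain ⟨hv, rfl⟩ := hv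
    exact ⟨y, by simpa using hv, rfl⟩

theorem sum_comp_le_sum_univ {ι R : Type*} [Fintype R] [DecidableEq R] (P : Finset ι) (g : ι → R)
    (hg : Set.InjOn g (P : Set ι)) (f : R → ℕ) : ∑ p ∈ P, f (g p) ≤ ∑ x, f x := by
  rw [← Finset.sum_image (s := P) (f := f) (g := g) fun x hx y hy h => hg hx hy h]
  exact Finset.sum_le_sum_of_subset (Finset.subset_univ _)

/-- The number of points `(h, y)` of the slice over `h` in the sets `bad p`, `p ∈ P`. -/
def load {ι R U : Type*} [Fintype U] [DecidableEq R] [DecidableEq U] (P : Finset ι)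
    (bad : ι → Finset (R × U)) (h : R) : ℕ :=
  ∑ p ∈ P, (Finset.univ.filter (fun y => (h, y) ∈ bad p)).card

/-- If the sets `bad p` are small, fewer than half of the slices are overloaded. -/
theorem card_overloaded_lt {ι κ R U : Type*} [Fintype R] [Fintype U] [DecidableEq R]
    [DecidableEq U] {P : Finset ι} {bad : ι → Finset (R × U)} {K w : ℕ}
    (h : ∀ p ∈ P, K * (bad p).card ≤ 2 * w) {P' : Finset κ} {g : κ → R}
    (hg : Set.InjOn g (P' : Set κ)) (hP : 0 < P.card) :
    2 * (P'.filter (fun q => 4 * w < K * load P bad (g q))).card < P.card := by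
  set F := P'.filter (fun q => 4 * w < K * load P bad (g q)) with hF
  rcases F.eq_empty_or_nonempty with h0 | h0
  · rw [h0]; simpa using hP
  have h1 : ∑ x, load P bad x = ∑ p ∈ P, (bad p).card := by
    simp only [load]
    rw [Finset.sum_comm]
    exact Finset.sum_congr rfl fun p _ => sum_card_slice (bad p)
  have h2 : ∑ q ∈ F, load P bad (g q) ≤ ∑ x, load P bad x :=
    sum_comp_le_sum_univ F g (hg.mono (by
      intro x hx; exact Finset.mem_coe.2 (Finset.filter_subset _ _ (Finset.mem_coe.1 hx)))) _
  have h3 : ∑ q ∈ F, 4 * w < ∑ q ∈ F, K * load P bad (g q) :=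
    Finset.sum_lt_sum_of_nonempty h0 fun q hq => (Finset.mem_filter.1 hq).2
  have h4 : K * ∑ p ∈ P, (bad p).card ≤ P.card * (2 * w) := by
    rw [Finset.mul_sum, ← smul_eq_mul (P.card)]
    exact Finset.sum_le_card_nsmul _ _ _ h
  rw [Finset.sum_const, smul_eq_mul, ← Finset.mul_sum] at h3
  have h5 := Nat.mul_le_mul_left K (h2.trans_eq h1)
  have h6 : F.card * (4 * w) < P.card * (2 * w) := h3.trans_le (h5.trans h4)
  nlinarith

/-- A vertex that reaches almost all vertices of a transversal, few of which are weak, reaches a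
positive proportion of all vertices. -/
theorem card_reached_of_spread {V R U : Type} [Fintype R] [Fintype U] [DecidableEq R]
    [DecidableEq U] {ρ : V → V → Prop} {e : R → R × U → V} {alive : R → R × U → Prop}
    {P : Finset (R × R)} (hP₁ : Set.InjOn Prod.fst (P : Set (R × R)))
    (hP₂ : Set.InjOn Prod.snd (P : Set (R × R))) (hR : Fintype.card R = 2 ^ 16 * P.card)
    (hU : 0 < Fintype.card U) {z : V} {h : R} {Z : Finset (R × U)}
    (hZ : 2 ^ 20 * Z.card ≤ 2 * Fintype.card (R × U))
    (hz : ∀ i y, (i, y) ∉ Z → alive i (h, y) → ReflTransGen ρ z (e i (h, y)))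
    (hload : 2 ^ 20 * load P (weak (2 ^ 20) ρ e alive) h ≤ 4 * Fintype.card (R × U))
    {T : Finset (R × (R × U))}
    (hT : ∀ i x, alive i x → ReflTransGen ρ z (e i x) → (i, x) ∈ T) :
    Fintype.card (R × (R × U)) ≤ 2 ^ 18 * T.card := by
  classical
  set w := Fintype.card (R × U) with hw
  have hw' : w = Fintype.card R * Fintype.card U := Fintype.card_prod _ _
  set u := Fintype.card U with hu
  -- `F` consists of the walks that cannot be used: at their first level every point of the slice
  -- over `h` is either missed by `z` or weak.
  let F := P.filter (fun p => ∀ y, (p.1, y) ∈ Z ∨ (h, y) ∈ weak (2 ^ 20) ρ e alive p)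
  have hFP : F ⊆ P := Finset.filter_subset _ _
  have hF : F.card * u ≤ Z.card + load P (weak (2 ^ 20) ρ e alive) h := by
    have h1 : ∑ p ∈ F, (Finset.univ.filter (fun y => (p.1, y) ∈ Z)).card ≤ Z.card := by
      rw [← sum_card_slice Z]
      exact sum_comp_le_sum_univ F Prod.fst (hP₁.mono (by exact_mod_cast hFP))
        (fun x => (Finset.univ.filter (fun y => (x, y) ∈ Z)).card)
    have h2 : ∑ p ∈ F, (Finset.univ.filter
        (fun y => (h, y) ∈ weak (2 ^ 20) ρ e alive p)).card ≤
          load P (weak (2 ^ 20) ρ e alive) h :=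
      Finset.sum_le_sum_of_subset hFP
    have h3 : F.card * u ≤ ∑ p ∈ F, ((Finset.univ.filter (fun y => (p.1, y) ∈ Z)).card +
        (Finset.univ.filter (fun y => (h, y) ∈ weak (2 ^ 20) ρ e alive p)).card) := by
      rw [← smul_eq_mul]
      refine Finset.card_nsmul_le_sum _ _ _ fun p hp => ?_
      refine le_trans ?_ (Finset.card_union_le _ _)
      rw [hu, ← Finset.card_univ]
      refine Finset.card_le_card fun y _ => ?_
      simpa using (Finset.mem_filter.1 hp).2 y
    rw [Finset.sum_add_distrib] at h3
    omega
  -- Misses and load together are at most `6 * 2 ^ (-20)` of `|R| * |U|`; as `|R| = 2 ^ 16 * |P|`,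
  -- at most `3 / 8` of the walks are lost.
  have hF2 : 2 * F.card ≤ P.card := by
    have h1 : (2 ^ 20 * F.card) * u ≤ (6 * Fintype.card R) * u := by
      calc (2 ^ 20 * F.card) * u = 2 ^ 20 * (F.card * u) := by ring
        _ ≤ 2 ^ 20 * (Z.card + load P (weak (2 ^ 20) ρ e alive) h) := Nat.mul_le_mul_left _ hF
        _ ≤ 6 * w := by omega
        _ = _ := by rw [hw']; ring
    have h2 := Nat.le_of_mul_le_mul_right h1 hU
    omega
  have hslice : ∀ p ∈ P \ F, w ≤ 2 * (Finset.univ.filter (fun y => (p.2, y) ∈ T)).card := by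
    intro p hp
    obtain ⟨hpP, hpF⟩ := Finset.mem_sdiff.1 hp
    have : ∃ y, (p.1, y) ∉ Z ∧ (h, y) ∉ weak (2 ^ 20) ρ e alive p := by
      by_contra! hcon
      refine hpF (Finset.mem_filter.2 ⟨hpP, fun y => ?_⟩)
      by_cases hy : (p.1, y) ∈ Z
      · exact Or.inl hy
      · exact Or.inr (hcon y hy)
    obtain ⟨y, hyZ, hyw⟩ := this
    simp only [weak, Finset.mem_filter, Finset.mem_univ, true_and, not_not] at hyw
    obtain ⟨hal, hun⟩ := hyw
    have hzy := hz p.1 y hyZ hal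
    have hsub : (unreached ρ e alive {e p.1 (h, y)} p.2)ᶜ ⊆
        Finset.univ.filter (fun y => (p.2, y) ∈ T) := by
      intro x hx
      simp only [unreached, Finset.mem_compl, Finset.mem_filter, Finset.mem_univ, true_and,
        not_not, Finset.mem_singleton, exists_eq_left] at hx ⊢
      exact hT _ _ hx.1 (hzy.trans hx.2)
    have h1 := Finset.card_le_card hsub
    have h2 := Finset.card_add_card_compl (unreached ρ e alive {e p.1 (h, y)} p.2)
    omega
  have hTc : ∑ p ∈ P \ F, (Finset.univ.filter (fun y => (p.2, y) ∈ T)).card ≤ T.card := by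
    rw [← sum_card_slice T]
    exact sum_comp_le_sum_univ (P \ F) Prod.snd
      (hP₂.mono (by exact_mod_cast (Finset.sdiff_subset : P \ F ⊆ P)))
        (fun x => (Finset.univ.filter (fun y => (x, y) ∈ T)).card)
  have h1 : (P \ F).card * w ≤ 2 * T.card := by
    refine le_trans ?_ (Nat.mul_le_mul_left 2 hTc)
    rw [Finset.mul_sum, ← smul_eq_mul]
    exact Finset.card_nsmul_le_sum _ _ _ hslice
  have h2 : P.card ≤ 2 * (P \ F).card := by
    rw [Finset.card_sdiff_of_subset hFP]; omega
  -- Half of the walks, each giving half of its last level, out of `2 ^ 16 * |P|` levels: hence the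
  -- factor `2 ^ 18`.
  rw [Fintype.card_prod, ← hw, hR]
  calc 2 ^ 16 * P.card * w ≤ 2 ^ 16 * (2 * (P \ F).card) * w := by gcongr
    _ = 2 ^ 17 * ((P \ F).card * w) := by ring
    _ ≤ 2 ^ 17 * (2 * T.card) := Nat.mul_le_mul_left _ h1
    _ = 2 ^ 18 * T.card := by ring

/-! ### The grate and its center -/

/-- The edges of `r` with both ends outside `D`. -/
def Avoid {V : Type*} (r : V → V → Prop) (D : Finset V) (u v : V) : Prop :=
  r u v ∧ u ∉ D ∧ v ∉ D

section Grate

variable {R U : Type} [Fintype R] [Fintype U] [DecidableEq R] [DecidableEq U]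

/-- Three copies of the product of `E` and `Q`, with the transposition of `R × (R × U)` leading from
each copy to the next. -/
def grateEdges (E : Finset (R × R)) (Q : Finset ((R × U) × (R × U))) :
    Finset ((Fin 3 × R × (R × U)) × (Fin 3 × R × (R × U))) :=
  ((Finset.univ : Finset (Fin 3)) ×ˢ E ×ˢ Q).image
      (fun p => ((p.1, p.2.1.1, p.2.2.1), (p.1, p.2.1.2, p.2.2.2))) ∪
  (Finset.univ : Finset (Fin 2 × R × (R × U))).image
      (fun p => ((p.1.castSucc, p.2.1, (p.2.2.1, p.2.2.2)),
        (p.1.succ, p.2.2.1, (p.2.1, p.2.2.2))))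

theorem level_mem_grateEdges {E : Finset (R × R)} {Q : Finset ((R × U) × (R × U))} (c : Fin 3)
    {i i' : R} {x x' : R × U} (h : (i, i') ∈ E) (h' : (x, x') ∈ Q) :
    ((c, i, x), (c, i', x')) ∈ grateEdges E Q :=
  Finset.mem_union_left _ (Finset.mem_image.2 ⟨(c, (i, i'), (x, x')), by simp [h, h'], rfl⟩)

theorem jump_mem_grateEdges (E : Finset (R × R)) (Q : Finset ((R × U) × (R × U))) (c : Fin 2)
    (h i : R) (y : U) : ((c.castSucc, h, (i, y)), (c.succ, i, (h, y))) ∈ grateEdges E Q :=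
  Finset.mem_union_right _ (Finset.mem_image.2 ⟨(c, h, (i, y)), Finset.mem_univ _, rfl⟩)

theorem card_grateEdges_le (E : Finset (R × R)) (Q : Finset ((R × U) × (R × U))) :
    (grateEdges E Q).card ≤ 3 * (E.card * Q.card) + 2 * Fintype.card (R × (R × U)) := by
  refine (Finset.card_union_le _ _).trans (Nat.add_le_add ?_ ?_)
  · refine Finset.card_image_le.trans ?_
    simp
  · refine Finset.card_image_le.trans ?_
    simp

theorem exists_rank_grateEdges {E : Finset (R × R)} (Q : Finset ((R × U) × (R × U)))
    {rank : R → ℕ} (hrank : ∀ u v, (u, v) ∈ E → rank u < rank v) :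
    ∃ f : Fin 3 × R × (R × U) → ℕ, ∀ u v, (u, v) ∈ grateEdges E Q → f u < f v := by
  have hle : ∀ i, rank i ≤ ∑ j, rank j := fun i =>
    Finset.single_le_sum (f := rank) (fun _ _ => Nat.zero_le _) (Finset.mem_univ i)
  -- The copies occupy disjoint blocks of ranks, so a jump increases the rank whatever the two
  -- levels are.
  refine ⟨fun v => v.1.1 * (∑ j, rank j + 1) + rank v.2.1, fun u v huv => ?_⟩
  rcases Finset.mem_union.1 huv with h | h
  · obtain ⟨p, hp, hpe⟩ := Finset.mem_image.1 h
    simp only [Prod.mk.injEq] at hpe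
    obtain ⟨rfl, rfl⟩ := hpe
    simp only [Finset.mem_product, Finset.mem_univ, true_and] at hp
    exact Nat.add_lt_add_left (hrank _ _ hp.1) _
  · obtain ⟨p, -, hpe⟩ := Finset.mem_image.1 h
    simp only [Prod.mk.injEq] at hpe
    obtain ⟨rfl, rfl⟩ := hpe
    have h1 := hle p.2.1
    simp only [Fin.val_castSucc, Fin.val_succ, add_mul, one_mul]
    omega

/-- Few vertices are deleted, so few levels lose a noticeable part. -/
theorem card_bad_levels_le (D : Finset (Fin 3 × R × (R × U)))
    (hD : 2 ^ 35 * D.card ≤ Fintype.card (R × (R × U))) (hW : 0 < Fintype.card (R × U))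
    (c : Fin 3) :
    2 ^ 15 * (Finset.univ.filter (fun i : R => Fintype.card (R × U) <
      2 ^ 20 * (dead (fun i x => (c, i, x) ∉ D) i).card)).card ≤ Fintype.card R := by
  classical
  set S := Finset.univ.filter (fun i : R => Fintype.card (R × U) <
      2 ^ 20 * (dead (fun i x => (c, i, x) ∉ D) i).card)
  set w := Fintype.card (R × U)
  let Dc : Finset (R × (R × U)) := Finset.univ.filter (fun p => (c, p) ∈ D)
  have hDc : Dc.card ≤ D.card := by
    refine Finset.card_le_card_of_injOn (fun p => (c, p)) ?_ ?_
    · intro p hp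
      simpa [Dc] using hp
    · intro p _ p' _ h
      exact congrArg Prod.snd h
  have h1 : ∑ i, (dead (fun i x => (c, i, x) ∉ D) i).card = Dc.card := by
    rw [← sum_card_slice Dc]
    refine Finset.sum_congr rfl fun i _ => ?_
    congr 1
    ext x
    simp [dead, Dc]
  have h2 : S.card * w ≤ 2 ^ 20 * Dc.card := by
    rw [← h1, Finset.mul_sum, ← smul_eq_mul]
    refine (Finset.card_nsmul_le_sum S
      (fun i => 2 ^ 20 * (dead (fun i x => (c, i, x) ∉ D) i).card) _ ?_).trans
      (Finset.sum_le_sum_of_subset (Finset.subset_univ _))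
    intro i hi
    exact (Finset.mem_filter.1 hi).2.le
  have h3 : (2 ^ 15 * S.card) * w ≤ Fintype.card R * w := by
    calc (2 ^ 15 * S.card) * w = 2 ^ 15 * (S.card * w) := by ring
      _ ≤ 2 ^ 15 * (2 ^ 20 * D.card) :=
        Nat.mul_le_mul_left _ (h2.trans (Nat.mul_le_mul_left _ hDc))
      _ = 2 ^ 35 * D.card := by ring
      _ ≤ _ := by rw [Fintype.card_prod] at hD; exact hD
  exact Nat.le_of_mul_le_mul_right h3 hW

/-- After the deletion of a small proportion of the vertices, some vertex of the grate still has a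
positive proportion of the first copy as ancestors and of the last copy as descendants. -/
theorem exists_center {E : Finset (R × R)} {Q : Finset ((R × U) × (R × U))} {m M : ℕ}
    (hE : ∀ S : Finset R, 2 ^ 14 * S.card ≤ Fintype.card R →
      ∃ u v, Walk (fun u v => (u, v) ∈ E ∧ u ∉ S ∧ v ∉ S) ((m + 1) + (m + 1)) u v)
    (hQ : IsDisperser (2 ^ 20) Q) (hR : Fintype.card R = 2 ^ 16 * M) (hM : 0 < M)
    (hU : 0 < Fintype.card U) (hm : Fintype.card (R × U) ≤ 2 ^ m)
    (D : Finset (Fin 3 × R × (R × U)))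
    (hD : 2 ^ 35 * D.card ≤ Fintype.card (R × (R × U))) :
    ∃ z ∉ D, ∃ TA TB : Finset (R × (R × U)),
      Fintype.card (R × (R × U)) ≤ 2 ^ 18 * TA.card ∧
      Fintype.card (R × (R × U)) ≤ 2 ^ 18 * TB.card ∧
      (∀ p ∈ TA, (0, p) ∉ D ∧
        ReflTransGen (Avoid (fun u v => (u, v) ∈ grateEdges E Q) D) (0, p) z) ∧
      (∀ p ∈ TB, (2, p) ∉ D ∧
        ReflTransGen (Avoid (fun u v => (u, v) ∈ grateEdges E Q) D) z (2, p)) := by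
  classical
  set ρ := Avoid (fun u v => (u, v) ∈ grateEdges E Q) D with hρ
  have hW : 0 < Fintype.card (R × U) := by
    rw [Fintype.card_prod, hR]; positivity
  let alive : Fin 3 → R → R × U → Prop := fun c i x => (c, i, x) ∉ D
  let e : Fin 3 → R → R × U → Fin 3 × R × (R × U) := fun c i x => (c, i, x)
  let S : Fin 3 → Finset R := fun c => Finset.univ.filter (fun i : R => Fintype.card (R × U) <
      2 ^ 20 * (dead (alive c) i).card)
  have hS : ∀ c, 2 ^ 15 * (S c).card ≤ Fintype.card R := card_bad_levels_le D hD hW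
  let r : Fin 3 → R → R → Prop := fun c u v => (u, v) ∈ E ∧ u ∉ S c ∧ v ∉ S c
  have hgood : ∀ c i i', r c i i' →
      2 ^ 20 * (dead (alive c) i).card ≤ Fintype.card (R × U) ∧
      2 ^ 20 * (dead (alive c) i').card ≤ Fintype.card (R × U) := by
    rintro c i i' ⟨-, h1, h2⟩
    simp only [S, Finset.mem_filter, Finset.mem_univ, true_and, not_lt] at h1 h2
    exact ⟨h1, h2⟩
  have hstep : ∀ c i i' x x', r c i i' → (x, x') ∈ Q → alive c i x → alive c i' x' →
      ρ (e c i x) (e c i' x') := fun c i i' x x' h1 h2 h3 h4 =>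
    ⟨level_mem_grateEdges c h1.1 h2, h3, h4⟩
  have hstep' : ∀ c i i' x x', r c i' i → (x, x') ∈ Q.image Prod.swap → alive c i x →
      alive c i' x' → ρ (e c i' x') (e c i x) := by
    intro c i i' x x' h1 h2 h3 h4
    obtain ⟨⟨a, b⟩, hab, h⟩ := Finset.mem_image.1 h2
    simp only [Prod.swap_prod_mk, Prod.mk.injEq] at h
    obtain ⟨rfl, rfl⟩ := h
    exact hstep c _ _ _ _ h1 hab h4 h3
  choose P hPc hP₁ hP₂ hP using fun c => exists_walk_matching (by omega) hE (hS c) M hR.ge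
  have hm' : Fintype.card (R × U) ≤ 2 ^ (m + 1 + m) :=
    hm.trans (Nat.pow_le_pow_right (by norm_num) (by omega))
  -- the last copy
  have hwB : ∀ p ∈ P 2, 2 ^ 20 * (weak (2 ^ 20) ρ (e 2) (alive 2) p).card ≤
      2 * Fintype.card (R × U) := fun p hp =>
    card_weak_le (by norm_num) hQ (hstep 2) (hgood 2) hW hm' (hP 2 p hp)
  -- the first copy, with all edges reversed
  let PA := (P 0).image Prod.swap
  have hPA : PA.card = M := by
    rw [Finset.card_image_of_injective _ Prod.swap_injective, hPc]
  have hPA₁ : Set.InjOn Prod.fst (PA : Set (R × R)) := by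
    intro p hp p' hp' h
    obtain ⟨a, ha, rfl⟩ := Finset.mem_image.1 (Finset.mem_coe.1 hp)
    obtain ⟨b, hb, rfl⟩ := Finset.mem_image.1 (Finset.mem_coe.1 hp')
    rw [hP₂ 0 ha hb h]
  have hPA₂ : Set.InjOn Prod.snd (PA : Set (R × R)) := by
    intro p hp p' hp' h
    obtain ⟨a, ha, rfl⟩ := Finset.mem_image.1 (Finset.mem_coe.1 hp)
    obtain ⟨b, hb, rfl⟩ := Finset.mem_image.1 (Finset.mem_coe.1 hp')
    rw [hP₁ 0 ha hb h]
  have hwA : ∀ p ∈ PA, 2 ^ 20 * (weak (2 ^ 20) (fun u v => ρ v u) (e 0) (alive 0) p).card ≤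
      2 * Fintype.card (R × U) := by
    intro p hp
    obtain ⟨a, ha, rfl⟩ := Finset.mem_image.1 hp
    exact card_weak_le (r := fun u v => r 0 v u) (by norm_num) hQ.swap (hstep' 0)
      (fun i i' h => (hgood 0 i' i h).symm) hW hm' (hP 0 a ha).flip
  -- a walk in the middle copy whose two ends are not overloaded
  obtain ⟨q, hq, hqB, hqA⟩ : ∃ q ∈ P 1,
      2 ^ 20 * load (P 2) (weak (2 ^ 20) ρ (e 2) (alive 2)) q.2 ≤ 4 * Fintype.card (R × U) ∧
      2 ^ 20 * load PA (weak (2 ^ 20) (fun u v => ρ v u) (e 0) (alive 0)) q.1 ≤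
        4 * Fintype.card (R × U) := by
    have h1 := card_overloaded_lt hwB (hP₂ 1) (by rw [hPc]; exact hM)
    have h2 := card_overloaded_lt hwA (hP₁ 1) (by rw [hPA]; exact hM)
    rw [hPc] at h1
    rw [hPA] at h2
    by_contra! hcon
    have hsub : P 1 ⊆ (P 1).filter (fun q => 4 * Fintype.card (R × U) <
          2 ^ 20 * load (P 2) (weak (2 ^ 20) ρ (e 2) (alive 2)) q.2) ∪
        (P 1).filter (fun q => 4 * Fintype.card (R × U) <
          2 ^ 20 * load PA (weak (2 ^ 20) (fun u v => ρ v u) (e 0) (alive 0)) q.1) := by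
      intro q hq
      rw [Finset.mem_union, Finset.mem_filter, Finset.mem_filter]
      rcases le_or_gt (2 ^ 20 * load (P 2) (weak (2 ^ 20) ρ (e 2) (alive 2)) q.2)
        (4 * Fintype.card (R × U)) with h | h
      · exact Or.inr ⟨hq, hcon q hq h⟩
      · exact Or.inl ⟨hq, h⟩
    have h3 := (Finset.card_le_card hsub).trans (Finset.card_union_le _ _)
    rw [hPc] at h3
    omega
  -- The center lies on the level halfway along the walk: most points there reach almost all of
  -- level `q.2`, most are reached from almost all of level `q.1`, so some point does both.
  obtain ⟨j, hj₁, hj₂⟩ := (hP 1 q hq).split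
  have hfw : 2 ^ 20 * (weak (2 ^ 20) ρ (e 1) (alive 1) (j, q.2)).card ≤
      2 * Fintype.card (R × U) :=
    card_weak_le (by norm_num) hQ (hstep 1) (hgood 1) hW hm hj₂
  have hbw : 2 ^ 20 * (weak (2 ^ 20) (fun u v => ρ v u) (e 1) (alive 1) (j, q.1)).card ≤
      2 * Fintype.card (R × U) :=
    card_weak_le (r := fun u v => r 1 v u) (by norm_num) hQ.swap (hstep' 1)
      (fun i i' h => (hgood 1 i' i h).symm) hW hm hj₁.flip
  obtain ⟨x, hx₁, hx₂⟩ : ∃ x, x ∉ weak (2 ^ 20) ρ (e 1) (alive 1) (j, q.2) ∧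
      x ∉ weak (2 ^ 20) (fun u v => ρ v u) (e 1) (alive 1) (j, q.1) := by
    by_contra! hcon
    have hsub : (Finset.univ : Finset (R × U)) ⊆ weak (2 ^ 20) ρ (e 1) (alive 1) (j, q.2) ∪
        weak (2 ^ 20) (fun u v => ρ v u) (e 1) (alive 1) (j, q.1) := by
      intro x _
      rw [Finset.mem_union]
      by_cases h : x ∈ weak (2 ^ 20) ρ (e 1) (alive 1) (j, q.2)
      · exact Or.inl h
      · exact Or.inr (hcon x h)
    have h3 := (Finset.card_le_card hsub).trans (Finset.card_union_le _ _)
    rw [Finset.card_univ] at h3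
    omega
  simp only [weak, Finset.mem_filter, Finset.mem_univ, true_and, not_not] at hx₁ hx₂
  refine ⟨e 1 j x, hx₁.1,
    Finset.univ.filter (fun p => (0, p) ∉ D ∧ ReflTransGen ρ (0, p) (e 1 j x)),
    Finset.univ.filter (fun p => (2, p) ∉ D ∧ ReflTransGen ρ (e 1 j x) (2, p)), ?_, ?_, ?_, ?_⟩
  · refine card_reached_of_spread (ρ := fun u v => ρ v u) (e := e 0) (alive := alive 0)
      hPA₁ hPA₂ (by rw [hPA, hR]) hU (z := e 1 j x) (h := q.1) hx₂.2 ?_ hqA ?_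
    · intro i y hiy hal
      simp only [unreached, Finset.mem_filter, Finset.mem_univ, true_and, not_not,
        Finset.mem_singleton, exists_eq_left] at hiy
      -- The transposition leads from `(i, (q.1, y))` in copy 0 to `(q.1, (i, y))` in copy 1: one
      -- level of the middle copy meets the slice over `q.1` in every level of the first copy.
      exact hiy.2.tail ⟨jump_mem_grateEdges E Q 0 i q.1 y, hal, hiy.1⟩
    · intro i y hal hr
      rw [Finset.mem_filter]
      exact ⟨Finset.mem_univ _, hal, reflTransGen_swap.1 hr⟩
  · refine card_reached_of_spread (ρ := ρ) (e := e 2) (alive := alive 2)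
      (hP₁ 2) (hP₂ 2) (by rw [hPc, hR]) hU (z := e 1 j x) (h := q.2) hx₁.2 ?_ hqB ?_
    · intro i y hiy hal
      simp only [unreached, Finset.mem_filter, Finset.mem_univ, true_and, not_not,
        Finset.mem_singleton, exists_eq_left] at hiy
      exact hiy.2.tail ⟨jump_mem_grateEdges E Q 1 q.2 i y, hiy.1, hal⟩
    · intro i y hal hr
      rw [Finset.mem_filter]
      exact ⟨Finset.mem_univ _, hal, hr⟩
  · intro p hp
    exact (Finset.mem_filter.1 hp).2
  · intro p hp
    exact (Finset.mem_filter.1 hp).2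

end Grate

/-! ### Choosing the parameters of the grate -/

/-- Used with exponent 88, which bounds `|R| ^ 2`, so that rounding `|U|` up costs only a constant
factor in the size of the grate. -/
theorem exists_pow_le_mul_two_pow (k : ℕ) : ∃ C : ℕ, ∀ a : ℕ, (2 * (a + 1)) ^ k ≤ C * 2 ^ a := by
  have h := tendsto_pow_const_div_const_pow_of_one_lt k (show (1 : ℝ) < 2 by norm_num)
  obtain ⟨B, hB⟩ := h.bddAbove_range
  obtain ⟨N, hN⟩ := exists_nat_ge B
  refine ⟨2 ^ k * (N * 2), fun a => ?_⟩
  have h1 : ((a + 1 : ℕ) : ℝ) ^ k / 2 ^ (a + 1) ≤ B := hB ⟨a + 1, rfl⟩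
  rw [div_le_iff₀ (by positivity)] at h1
  have h2 : ((a + 1 : ℕ) : ℝ) ^ k ≤ N * 2 ^ (a + 1) :=
    h1.trans (mul_le_mul_of_nonneg_right hN (by positivity))
  have h3 : (a + 1) ^ k ≤ N * 2 ^ (a + 1) := by exact_mod_cast h2
  calc (2 * (a + 1)) ^ k = 2 ^ k * (a + 1) ^ k := mul_pow _ _ _
    _ ≤ 2 ^ k * (N * 2 ^ (a + 1)) := Nat.mul_le_mul_left _ h3
    _ = 2 ^ k * (N * 2) * 2 ^ a := by ring

/-- Sparse acyclic graphs on `Θ(2 ^ a)` vertices in which, after the deletion of fewer than `2 ^ a`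
vertices, some vertex still has a positive proportion of ancestors and of descendants. -/
theorem exists_grate : ∃ C : ℕ, ∀ a : ℕ, ∃ (A V : Type) (_ : Fintype A) (_ : Fintype V)
    (E : Finset (V × V)) (src tgt : A → V),
    2 ^ a ≤ Fintype.card A ∧ Fintype.card A ≤ C * 2 ^ a ∧ Fintype.card V ≤ C * 2 ^ a ∧
    E.card ≤ C * 2 ^ a ∧ (∃ rank : V → ℕ, ∀ u v, (u, v) ∈ E → rank u < rank v) ∧
    ∀ D : Finset V, D.card < 2 ^ a → ∃ z ∉ D, ∃ TA TB : Finset A,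
      Fintype.card A ≤ 2 ^ 18 * TA.card ∧ Fintype.card A ≤ 2 ^ 18 * TB.card ∧
      (∀ p ∈ TA, src p ∉ D ∧ ReflTransGen (Avoid (fun u v => (u, v) ∈ E) D) (src p) z) ∧
      (∀ p ∈ TB, tgt p ∉ D ∧ ReflTransGen (Avoid (fun u v => (u, v) ∈ E) D) z (tgt p)) := by
  classical
  obtain ⟨δ₁, hδ₁⟩ := exists_depthRobust
  obtain ⟨δ₂, hδ₂⟩ := exists_disperser (2 ^ 20) (by norm_num)
  obtain ⟨C', hC'⟩ := exists_pow_le_mul_two_pow 88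
  refine ⟨(3 * (δ₁ * δ₂) + 3) * (2 ^ 35 + C'), fun a => ?_⟩
  -- With `2 ^ τ` of order `a`, the set `R` has size polynomial in `a`, yet the depth `2 ^ (20 * τ)`
  -- exceeds twice the logarithm of `|W|`.
  obtain ⟨τ, hτ, haτ, hτa⟩ : ∃ τ, 1 ≤ τ ∧ a + 1 < 2 ^ τ ∧ 2 ^ τ ≤ 2 * (a + 1) := by
    refine ⟨Nat.log 2 (a + 1) + 1, by omega, Nat.lt_pow_succ_log_self (by norm_num) _, ?_⟩
    rw [pow_succ, mul_comm]
    exact Nat.mul_le_mul_left _ (Nat.pow_log_le_self 2 (by omega))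
  obtain ⟨E, hEc, ⟨rank, hrank⟩, hE⟩ := hδ₁ τ hτ
  set s := Fintype.card (ScaleVertex (32 * τ)) with hs
  have hs' : s = 2 ^ (32 * τ) * (32 * τ) ^ 2 := card_scaleVertex _
  have hs0 : 0 < s := by rw [hs']; positivity
  have hsM : s = 2 ^ 16 * (2 ^ (32 * τ - 16) * (32 * τ) ^ 2) := by
    rw [hs', ← mul_assoc, ← pow_add]; congr 2; omega
  have hττ : τ < 2 ^ τ := Nat.lt_two_pow_self
  have hs2 : s * s ≤ 2 ^ (88 * τ) := by
    have h1 : 32 * τ ≤ 2 ^ (6 * τ) := by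
      calc 32 * τ ≤ 2 ^ 5 * 2 ^ τ := Nat.mul_le_mul_left _ hττ.le
        _ = 2 ^ (5 + τ) := by rw [← pow_add]
        _ ≤ 2 ^ (6 * τ) := Nat.pow_le_pow_right (by norm_num) (by omega)
    have h2 : s ≤ 2 ^ (44 * τ) := by
      rw [hs']
      calc 2 ^ (32 * τ) * (32 * τ) ^ 2 ≤ 2 ^ (32 * τ) * (2 ^ (6 * τ)) ^ 2 := by gcongr
        _ = 2 ^ (44 * τ) := by rw [← pow_mul, ← pow_add]; congr 1; ring
    calc s * s ≤ 2 ^ (44 * τ) * 2 ^ (44 * τ) := Nat.mul_le_mul h2 h2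
      _ = 2 ^ (88 * τ) := by rw [← pow_add]; congr 1; ring
  have hs2C : s * s ≤ C' * 2 ^ a := by
    refine hs2.trans (le_trans ?_ (hC' a))
    rw [mul_comm, pow_mul]
    exact Nat.pow_le_pow_left hτa _
  -- `U` fills the copy up to at least `2 ^ (35 + a)` vertices, so that fewer than `2 ^ a` deletions
  -- are a proportion below `2 ^ (-35)`.
  set u := 2 ^ (35 + a) / (s * s) + 1 with hu
  have hN1 : 2 ^ (35 + a) ≤ s * (s * u) := by
    rw [← mul_assoc, hu]
    exact (Nat.lt_mul_div_succ _ (by positivity)).le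
  have hN2 : s * (s * u) ≤ 2 ^ (35 + a) + s * s := by
    rw [← mul_assoc, hu, mul_add, mul_one]
    exact Nat.add_le_add_right (Nat.mul_div_le _ _) _
  let R := ScaleVertex (32 * τ)
  have hA : Fintype.card (R × (R × Fin u)) = s * (s * u) := by
    rw [Fintype.card_prod R, Fintype.card_prod R, Fintype.card_fin]
  have hWc : Fintype.card (R × Fin u) = s * u := by
    rw [Fintype.card_prod R, Fintype.card_fin]
  have hW0 : 0 < Fintype.card (R × Fin u) := by rw [hWc]; positivity
  obtain ⟨Q, hQc, hQ⟩ := hδ₂ (R × Fin u) (R × Fin u) hW0 hW0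
  rw [max_self, hWc] at hQc
  set m := 36 + a + 128 * τ with hm
  have hmW : Fintype.card (R × Fin u) ≤ 2 ^ m := by
    rw [hWc]
    have h1 : s * u ≤ s * (s * u) := Nat.le_mul_of_pos_left _ hs0
    have h2 : 2 ^ (35 + a) ≤ 2 ^ (35 + a + 128 * τ) :=
      Nat.pow_le_pow_right (by norm_num) (by omega)
    have h3 : 2 ^ (88 * τ) ≤ 2 ^ (35 + a + 128 * τ) :=
      Nat.pow_le_pow_right (by norm_num) (by omega)
    have h4 : 2 ^ m = 2 * 2 ^ (35 + a + 128 * τ) := by rw [hm, ← pow_succ']; congr 1; ring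
    omega
  have hlen : (m + 1) + (m + 1) ≤ 2 ^ (20 * τ) := by
    have h1 : 2 ^ (20 * τ) = 2 ^ (19 * τ) * 2 ^ τ := by rw [← pow_add]; congr 1; ring
    have h2 : 2 ^ 19 ≤ 2 ^ (19 * τ) := Nat.pow_le_pow_right (by norm_num) (by omega)
    have h3 : 2 ^ 19 * 2 ^ τ ≤ 2 ^ (19 * τ) * 2 ^ τ := Nat.mul_le_mul_right _ h2
    omega
  have hE' : ∀ S : Finset R, 2 ^ 14 * S.card ≤ Fintype.card R →
      ∃ u v, Walk (fun u v => (u, v) ∈ E ∧ u ∉ S ∧ v ∉ S) ((m + 1) + (m + 1)) u v := by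
    intro S hS
    obtain ⟨x, y, hxy⟩ := hE S hS
    obtain ⟨k, hk⟩ := Nat.exists_eq_add_of_le hlen
    rw [hk] at hxy
    obtain ⟨v, hv, -⟩ := hxy.split
    exact ⟨x, v, hv⟩
  have hNC : s * (s * u) ≤ (2 ^ 35 + C') * 2 ^ a := by
    rw [add_mul, ← pow_add]; omega
  refine ⟨R × (R × Fin u), Fin 3 × R × (R × Fin u), inferInstance, inferInstance,
    grateEdges E Q, fun p => (0, p), fun p => (2, p), ?_, ?_, ?_, ?_,
    exists_rank_grateEdges Q hrank, fun D hD => ?_⟩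
  · rw [hA]
    exact (Nat.pow_le_pow_right (by norm_num) (by omega)).trans hN1
  · rw [hA]
    refine hNC.trans ?_
    rw [mul_assoc]
    exact Nat.le_mul_of_pos_left _ (by omega)
  · rw [Fintype.card_prod, hA, Fintype.card_fin, mul_assoc]
    exact Nat.mul_le_mul (by omega) hNC
  · refine (card_grateEdges_le E Q).trans ?_
    rw [hA, mul_assoc]
    calc 3 * (E.card * Q.card) + 2 * (s * (s * u))
        ≤ 3 * ((δ₁ * s) * (δ₂ * (s * u))) + 2 * (s * (s * u)) := by gcongr
      _ = (3 * (δ₁ * δ₂) + 2) * (s * (s * u)) := by ring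
      _ ≤ (3 * (δ₁ * δ₂) + 3) * ((2 ^ 35 + C') * 2 ^ a) := Nat.mul_le_mul (by omega) hNC
  · refine exists_center hE' hQ hsM (by positivity) (by rw [Fintype.card_fin]; exact Nat.succ_pos _) hmW D ?_
    rw [hA]
    refine le_trans ?_ hN1
    rw [pow_add]
    exact Nat.mul_le_mul_left _ hD.le

theorem Avoid.lift {V V' : Type*} {r : V → V → Prop} {r' : V' → V' → Prop} {D : Finset V}
    {D' : Finset V'} (f : V → V') (hr : ∀ u v, r u v → r' (f u) (f v))
    (hD : ∀ v, f v ∈ D' → v ∈ D) {u v : V} (h : ReflTransGen (Avoid r D) u v) :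
    ReflTransGen (Avoid r' D') (f u) (f v) := by
  refine ReflTransGen.lift (p := Avoid r' D') f ?_ _ _ h
  intro x y hxy
  exact ⟨hr _ _ hxy.1, fun h => hxy.2.1 (hD _ h), fun h => hxy.2.2 (hD _ h)⟩

/-! ### Linkers -/

/-- In the graph `E` with exits `X` to `A`, whatever `k` vertices other than inputs are deleted, any
`k + 1` inputs left still reach every dense subset of `A`. -/
def IsLinker {Λ A J : Type} [Fintype A] (E : Finset (Λ × Λ)) (X : Finset (Λ × A))
    (ι : J → Λ) : Prop :=
  ∀ (D : Finset Λ) (k : ℕ) (F : Finset Λ), (∀ v ∈ D, (∀ j, ι j ≠ v) → v ∈ F) → F.card ≤ k →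
    ∀ Y : Finset J, (∀ y ∈ Y, ι y ∉ D) → k + 1 ≤ Y.card →
    ∀ T : Finset A, Fintype.card A ≤ 2 ^ 18 * T.card →
      ∃ y ∈ Y, ∃ v ∉ D, ReflTransGen (Avoid (fun u v => (u, v) ∈ E) D) (ι y) v ∧
        ∃ t ∈ T, (v, t) ∈ X

section LinkerStep

variable {Λ A : Type} [DecidableEq Λ] {a : ℕ}

/-- The vertices of the linker with twice as many inputs. -/
abbrev LinkerVertex (Λ : Type) (a : ℕ) : Type := Fin (2 ^ (a + 1)) ⊕ (Λ ⊕ Fin (2 ^ a))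

/-- New inputs feed the inputs of the smaller linker through `Q`, and the exits of the latter become
edges into a middle layer of `2 ^ a` vertices. -/
def linkerEdges (E : Finset (Λ × Λ)) (X : Finset (Λ × Fin (2 ^ a))) (ι : Fin (2 ^ a) → Λ)
    (Q : Finset (Fin (2 ^ (a + 1)) × Fin (2 ^ a))) :
    Finset (LinkerVertex Λ a × LinkerVertex Λ a) :=
  Q.image (fun p => (.inl p.1, .inr (.inl (ι p.2)))) ∪
    (E.image (fun p => (.inr (.inl p.1), .inr (.inl p.2))) ∪
      X.image (fun p => (.inr (.inl p.1), .inr (.inr p.2))))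

/-- `Q₁` bypasses the smaller linker for large sets of inputs; `Q₂` leads from the middle layer to
the actual targets. -/
def linkerExits [DecidableEq A] (Q₁ : Finset (Fin (2 ^ (a + 1)) × A))
    (Q₂ : Finset (Fin (2 ^ a) × A)) : Finset (LinkerVertex Λ a × A) :=
  Q₁.image (fun p => (.inl p.1, p.2)) ∪ Q₂.image (fun p => (.inr (.inr p.1), p.2))

/-- A large set of inputs meets `T` through `Q₁` directly. A small one expands from `k + 1` to `2 *
(k + 1)` inputs of the smaller linker; at most `k` of these are deleted, so more than `k` remain and
the smaller linker applies with the same `k`. -/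
theorem isLinker_step [Fintype A] [DecidableEq A] {E : Finset (Λ × Λ)}
    {X : Finset (Λ × Fin (2 ^ a))} {ι : Fin (2 ^ a) → Λ} (hι : Function.Injective ι)
    (h : IsLinker E X ι) {Q : Finset (Fin (2 ^ (a + 1)) × Fin (2 ^ a))}
    (hQ : ∀ B : Finset (Fin (2 ^ (a + 1))), 1000 * B.card ≤ 2 ^ a →
      ∃ N : Finset (Fin (2 ^ a)), 2 * B.card ≤ N.card ∧ ∀ y ∈ N, ∃ x ∈ B, (x, y) ∈ Q)
    {Q₁ : Finset (Fin (2 ^ (a + 1)) × A)} (hQ₁ : IsDisperser (2 ^ 20) Q₁)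
    {Q₂ : Finset (Fin (2 ^ a) × A)} (hQ₂ : IsDisperser (2 ^ 20) Q₂) :
    IsLinker (linkerEdges E X ι Q) (linkerExits (Λ := Λ) Q₁ Q₂)
      (Sum.inl : Fin (2 ^ (a + 1)) → LinkerVertex Λ a) := by
  classical
  intro D k F hDF hF Y hY hYk T hT
  have hT' : Fintype.card A ≤ 2 ^ 20 * T.card := by omega
  rcases le_or_gt (1000 * (k + 1)) (2 ^ a) with hk | hk
  · have hinD : ∀ v : Λ ⊕ Fin (2 ^ a), Sum.inr v ∈ D → Sum.inr v ∈ F := fun v hv =>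
      hDF _ hv fun j => by simp
    obtain ⟨Y', hY', hY'c⟩ := Finset.exists_subset_card_eq hYk
    obtain ⟨N, hN, hNQ⟩ := hQ Y' (by omega)
    let Da : Finset Λ := (D.preimage (fun v => Sum.inr (Sum.inl v)) (by
      intro x _ y _ hxy; simpa using hxy))
    have hDa : ∀ v : Λ, v ∈ Da ↔ (Sum.inr (Sum.inl v) : LinkerVertex Λ a) ∈ D :=
      fun v => Finset.mem_preimage
    let Fa : Finset Λ := (F.preimage (fun v => Sum.inr (Sum.inl v)) (by
      intro x _ y _ hxy; simpa using hxy))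
    have hFa : Fa.card ≤ k := by
      refine le_trans ?_ hF
      refine Finset.card_le_card_of_injOn (fun v => Sum.inr (Sum.inl v)) ?_ ?_
      · intro v hv
        have hv' : v ∈ Fa := hv
        exact (Finset.mem_preimage (f := fun v => Sum.inr (Sum.inl v))).1 hv'
      · intro x _ y _ hxy; simpa using hxy
    let Y'' : Finset (Fin (2 ^ a)) := N.filter (fun y => ι y ∉ Da)
    have hY'' : k + 1 ≤ Y''.card := by
      have h1 : (N.filter (fun y => ¬ ι y ∉ Da)).card ≤ k := by
        refine le_trans ?_ hF
        refine Finset.card_le_card_of_injOn (fun y => Sum.inr (Sum.inl (ι y))) ?_ ?_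
        · intro y hy
          have hy' : ι y ∈ Da := by
            have := (Finset.mem_filter.1 (Finset.mem_coe.1 hy)).2
            simpa using this
          exact hinD _ ((hDa _).1 hy')
        · intro x _ y _ hxy
          have : ι x = ι y := by simpa using hxy
          exact hι this
      have h2 := Finset.card_filter_add_card_filter_not (s := N) (fun y => ι y ∉ Da)
      have h3 : Y''.card = (N.filter (fun y => ι y ∉ Da)).card := rfl
      omega
    -- The target for the smaller linker: surviving middle vertices with an exit into `T`. Only a `2
    -- ^ (-20)` fraction lacks such an exit and fewer than `2 ^ a / 1000` are deleted, so it is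
    -- dense.
    let T'' : Finset (Fin (2 ^ a)) := Finset.univ.filter (fun m =>
      (Sum.inr (Sum.inr m) : LinkerVertex Λ a) ∉ D ∧ ∃ t ∈ T, (m, t) ∈ Q₂)
    have hT'' : Fintype.card (Fin (2 ^ a)) ≤ 2 ^ 18 * T''.card := by
      let B : Finset (Fin (2 ^ a)) := Finset.univ.filter (fun m => ∀ t ∈ T, (m, t) ∉ Q₂)
      have hB : 2 ^ 20 * B.card < Fintype.card (Fin (2 ^ a)) := by
        by_contra! hcon
        obtain ⟨x, hx, t, ht, hxt⟩ := hQ₂ B T hcon hT'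
        exact (Finset.mem_filter.1 hx).2 t ht hxt
      let G : Finset (Fin (2 ^ a)) := Finset.univ.filter (fun m =>
        (Sum.inr (Sum.inr m) : LinkerVertex Λ a) ∈ D)
      have hG : G.card ≤ k := by
        refine le_trans ?_ hF
        refine Finset.card_le_card_of_injOn (fun y => Sum.inr (Sum.inr y)) ?_ ?_
        · intro y hy
          exact hinD _ (Finset.mem_filter.1 (Finset.mem_coe.1 hy)).2
        · intro x _ y _ hxy; simpa using hxy
      have hsub : (Finset.univ : Finset (Fin (2 ^ a))) ⊆ T'' ∪ B ∪ G := by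
        intro m _
        simp only [T'', B, G, Finset.mem_union, Finset.mem_filter, Finset.mem_univ, true_and]
        by_cases h1 : (Sum.inr (Sum.inr m) : LinkerVertex Λ a) ∈ D
        · exact Or.inr h1
        · by_cases h2 : ∃ t ∈ T, (m, t) ∈ Q₂
          · exact Or.inl (Or.inl ⟨h1, h2⟩)
          · push Not at h2
            exact Or.inl (Or.inr h2)
      have h1 := Finset.card_le_card hsub
      have h2 := Finset.card_union_le (T'' ∪ B) G
      have h3 := Finset.card_union_le T'' B
      rw [Finset.card_univ] at h1
      rw [Fintype.card_fin] at *
      omega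
    obtain ⟨y, hy, v, hv, hyv, m, hm, hvm⟩ := h Da k Fa (by
        intro v hv _
        exact Finset.mem_preimage.2 (hinD _ ((hDa v).1 hv))) hFa Y'' (fun y hy => (Finset.mem_filter.1 hy).2) hY'' T'' hT''
    obtain ⟨hyN, hyD⟩ := Finset.mem_filter.1 hy
    obtain ⟨x, hx, hxy⟩ := hNQ y hyN
    obtain ⟨-, hmD, t, ht, hmt⟩ := Finset.mem_filter.1 hm
    rw [hDa] at hv hyD
    refine ⟨x, hY' hx, .inr (.inr m), hmD, ?_, t, ht, ?_⟩
    · have hpath : ReflTransGen (Avoid (fun u v => (u, v) ∈ linkerEdges E X ι Q) D)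
          (.inr (.inl (ι y))) (.inr (.inl v)) := by
        refine Avoid.lift (fun v : Λ => (Sum.inr (Sum.inl v) : LinkerVertex Λ a)) ?_ ?_ hyv
        · intro u v huv
          exact Finset.mem_union_right _ (Finset.mem_union_left _
            (Finset.mem_image.2 ⟨(u, v), huv, rfl⟩))
        · intro v hv; exact (hDa v).2 hv
      refine (ReflTransGen.head ⟨?_, hY x (hY' hx), hyD⟩ hpath).tail ⟨?_, hv, hmD⟩
      · exact Finset.mem_union_right _ (Finset.mem_union_right _
          (Finset.mem_image.2 ⟨(v, m), hvm, rfl⟩))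
      · exact Finset.mem_union_left _ (Finset.mem_image.2 ⟨(x, y), hxy, rfl⟩)
    · exact Finset.mem_union_right _ (Finset.mem_image.2 ⟨(m, t), hmt, rfl⟩)
  · have h2 : 2 ^ (a + 1) = 2 ^ a * 2 := pow_succ _ _
    obtain ⟨x, hx, t, ht, hxt⟩ := hQ₁ Y T (by rw [Fintype.card_fin]; omega) hT'
    exact ⟨x, hx, .inl x, hY x hx, .refl, t, ht,
      Finset.mem_union_left _ (Finset.mem_image.2 ⟨(x, t), hxt, rfl⟩)⟩

theorem exists_rank_linkerEdges [Fintype Λ] {E : Finset (Λ × Λ)} {X : Finset (Λ × Fin (2 ^ a))}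
    {ι : Fin (2 ^ a) → Λ} {Q : Finset (Fin (2 ^ (a + 1)) × Fin (2 ^ a))} {rank : Λ → ℕ}
    (hrank : ∀ u v, (u, v) ∈ E → rank u < rank v) :
    ∃ f : LinkerVertex Λ a → ℕ, ∀ u v, (u, v) ∈ linkerEdges E X ι Q → f u < f v := by
  have hle : ∀ i, rank i ≤ ∑ j, rank j := fun i =>
    Finset.single_le_sum (f := rank) (fun _ _ => Nat.zero_le _) (Finset.mem_univ i)
  refine ⟨Sum.elim (fun _ => 0) (Sum.elim (fun v => rank v + 1) (fun _ => ∑ j, rank j + 2)),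
    fun u v huv => ?_⟩
  simp only [linkerEdges, Finset.mem_union, Finset.mem_image, Prod.mk.injEq] at huv
  rcases huv with ⟨p, hp, rfl, rfl⟩ | ⟨p, hp, rfl, rfl⟩ | ⟨p, hp, rfl, rfl⟩
  · simp
  · simpa using hrank _ _ hp
  · have := hle p.1
    simp only [Sum.elim_inr, Sum.elim_inl]
    omega

end LinkerStep

/-- Linkers with linearly many vertices and edges. -/
theorem exists_linker : ∃ C : ℕ, ∀ (a : ℕ) (A : Type) [Fintype A] [DecidableEq A],
    0 < Fintype.card A →
    ∃ (Λ : Type) (_ : Fintype Λ) (_ : DecidableEq Λ) (E : Finset (Λ × Λ)) (X : Finset (Λ × A))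
      (ι : Fin (2 ^ a) → Λ), Function.Injective ι ∧ Fintype.card Λ ≤ C * 2 ^ a ∧
      E.card ≤ C * 2 ^ a ∧ X.card ≤ C * (2 ^ a + Fintype.card A) ∧
      (∃ rank : Λ → ℕ, ∀ u v, (u, v) ∈ E → rank u < rank v) ∧ (∀ u j, (u, ι j) ∉ E) ∧
      IsLinker E X ι := by
  classical
  obtain ⟨δ, hδ⟩ := exists_disperser (2 ^ 20) (by norm_num)
  suffices ∀ (a : ℕ) (A : Type) [Fintype A] [DecidableEq A], 0 < Fintype.card A →
    ∃ (Λ : Type) (_ : Fintype Λ) (_ : DecidableEq Λ) (E : Finset (Λ × Λ)) (X : Finset (Λ × A))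
      (ι : Fin (2 ^ a) → Λ), Function.Injective ι ∧ Fintype.card Λ ≤ 3 * 2 ^ a ∧
      E.card ≤ (8 + 2 * (2 * δ + 1)) * 2 ^ a ∧ X.card ≤ (2 * δ + 1) * (2 ^ a + Fintype.card A) ∧
      (∃ rank : Λ → ℕ, ∀ u v, (u, v) ∈ E → rank u < rank v) ∧ (∀ u j, (u, ι j) ∉ E) ∧
      IsLinker E X ι by
    refine ⟨8 + 2 * (2 * δ + 1), fun a A _ _ hA => ?_⟩
    obtain ⟨Λ, i1, i2, E, X, ι, h1, h2, h3, h4, h5, h6, h7⟩ := this a A hA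
    exact ⟨Λ, i1, i2, E, X, ι, h1, h2.trans (Nat.mul_le_mul_right _ (by omega)), h3,
      h4.trans (Nat.mul_le_mul_right _ (by omega)), h5, h6, h7⟩
  intro a
  induction a with
  | zero =>
    intro A _ _ hA
    -- A single vertex with exits to all of `A`; here `k + 1 ≤ |Y|` just says that this vertex
    -- survives.
    refine ⟨Fin 1, inferInstance, inferInstance, ∅, Finset.univ, fun _ => 0, ?_, by simp, by simp,
      ?_, ⟨fun _ => 0, by simp⟩, by simp, ?_⟩
    · intro x y _
      exact Subsingleton.elim (α := Fin 1) x y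
    · rw [Finset.card_univ, Fintype.card_prod, Fintype.card_fin, one_mul]
      nlinarith
    · intro D k F _ _ Y hY hYk T hT
      obtain ⟨y, hy⟩ := Finset.card_pos.1 (by omega : 0 < Y.card)
      obtain ⟨t, ht⟩ := Finset.card_pos.1 (by omega : 0 < T.card)
      exact ⟨y, hy, 0, hY y hy, .refl, t, ht, Finset.mem_univ _⟩
  | succ a ih =>
    intro A _ _ hA
    -- The smaller linker aims at `Fin (2 ^ a)` instead of `A`, so `|A|` is not paid for again at
    -- every stage.
    obtain ⟨Λ, i1, i2, E, X, ι, h1, h2, h3, h4, ⟨rank, h5⟩, h6, h7⟩ := ih (Fin (2 ^ a)) (by simp)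
    obtain ⟨Q, hQc, hQ⟩ := exists_expander (Fin (2 ^ (a + 1))) (Fin (2 ^ a))
      (by simp [pow_succ, mul_comm]) (by simp)
    obtain ⟨Q₁, hQ₁c, hQ₁⟩ := hδ (Fin (2 ^ (a + 1))) A (by simp) hA
    obtain ⟨Q₂, hQ₂c, hQ₂⟩ := hδ (Fin (2 ^ a)) A (by simp) hA
    rw [Fintype.card_fin] at hQc hQ₁c hQ₂c h4
    refine ⟨LinkerVertex Λ a, inferInstance, inferInstance, linkerEdges E X ι Q,
      linkerExits Q₁ Q₂, Sum.inl, Sum.inl_injective, ?_, ?_, ?_, exists_rank_linkerEdges h5, ?_,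
      isLinker_step h1 h7 (fun B hB => ?_) hQ₁ hQ₂⟩
    · rw [Fintype.card_sum, Fintype.card_sum, Fintype.card_fin, Fintype.card_fin, pow_succ]
      omega
    · refine (Finset.card_union_le _ _).trans
        ((Nat.add_le_add_left (Finset.card_union_le _ _) _).trans ?_)
      have e1 : (Q.image (fun p => ((.inl p.1, .inr (.inl (ι p.2))) :
        LinkerVertex Λ a × LinkerVertex Λ a))).card ≤ Q.card := Finset.card_image_le
      have e2 : (E.image (fun p => ((.inr (.inl p.1), .inr (.inl p.2)) :
        LinkerVertex Λ a × LinkerVertex Λ a))).card ≤ E.card := Finset.card_image_le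
      have e3 : (X.image (fun p => ((.inr (.inl p.1), .inr (.inr p.2)) :
        LinkerVertex Λ a × LinkerVertex Λ a))).card ≤ X.card := Finset.card_image_le
      have e4 : 2 ^ (a + 1) = 2 ^ a * 2 := pow_succ _ _
      have e5 : (8 + 2 * (2 * δ + 1)) * 2 ^ (a + 1) = (8 + 2 * (2 * δ + 1)) * 2 ^ a +
          ((2 * δ + 1) * (2 ^ a + 2 ^ a) + 8 * 2 ^ a) := by rw [e4]; ring
      omega
    · refine (Finset.card_union_le _ _).trans ?_
      have e1 : (Q₁.image (fun p => ((.inl p.1, p.2) : LinkerVertex Λ a × A))).card ≤ Q₁.card :=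
        Finset.card_image_le
      have e2 : (Q₂.image (fun p => ((.inr (.inr p.1), p.2) : LinkerVertex Λ a × A))).card ≤
        Q₂.card := Finset.card_image_le
      have m1 : max (2 ^ (a + 1)) (Fintype.card A) ≤ 2 ^ (a + 1) + Fintype.card A := by omega
      have m2 : max (2 ^ a) (Fintype.card A) ≤ 2 ^ (a + 1) + Fintype.card A := by
        rw [pow_succ]; omega
      have := Nat.mul_le_mul_left δ m1
      have := Nat.mul_le_mul_left δ m2
      nlinarith
    · intro u j huj
      simp [linkerEdges] at huj
    · exact hQ B (by rw [Fintype.card_fin]; exact hB)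

/-- All but `|D|` inputs of a linker reach a given dense set outside `D`. -/
theorem IsLinker.exists_inputs {Λ A J : Type} [Fintype A] [Fintype J] {E : Finset (Λ × Λ)}
    {X : Finset (Λ × A)} {ι : J → Λ} (hι : Function.Injective ι) (h : IsLinker E X ι)
    (D : Finset Λ) (T : Finset A) (hT : Fintype.card A ≤ 2 ^ 18 * T.card) :
    ∃ G : Finset J, Fintype.card J ≤ D.card + G.card ∧ ∀ j ∈ G, ι j ∉ D ∧ ∃ v ∉ D,
      ReflTransGen (Avoid (fun u v => (u, v) ∈ E) D) (ι j) v ∧ ∃ t ∈ T, (v, t) ∈ X := by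
  classical
  set G : Finset J := Finset.univ.filter (fun j => ι j ∉ D ∧ ∃ v ∉ D,
      ReflTransGen (Avoid (fun u v => (u, v) ∈ E) D) (ι j) v ∧ ∃ t ∈ T, (v, t) ∈ X) with hG
  refine ⟨G, ?_, fun j hj => (Finset.mem_filter.1 hj).2⟩
  -- Deletions are split into non-inputs `F`, which bound the number of failing survivors, and
  -- inputs, each of which costs only itself; together the loss is at most `|D|`.
  let F := D.filter (fun v => ∀ j, ι j ≠ v)
  let B : Finset J := Finset.univ.filter (fun j => ι j ∈ D)
  let Y : Finset J := (G ∪ B)ᶜ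
  have hYD : ∀ y ∈ Y, ι y ∉ D := by
    intro y hy hyD
    simp only [Y, Finset.mem_compl, Finset.mem_union, not_or] at hy
    exact hy.2 (Finset.mem_filter.2 ⟨Finset.mem_univ _, hyD⟩)
  have hYF : Y.card ≤ F.card := by
    by_contra! hcon
    obtain ⟨y, hy, v, hv, hyv, t, ht, hvt⟩ := h D F.card F
      (fun v hv hj => Finset.mem_filter.2 ⟨hv, hj⟩) le_rfl Y hYD hcon T hT
    have hy' := hy
    simp only [Y, Finset.mem_compl, Finset.mem_union, not_or] at hy'
    exact hy'.1 (Finset.mem_filter.2 ⟨Finset.mem_univ _, hYD y hy, v, hv, hyv, t, ht, hvt⟩)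
  have hB : B.card ≤ (D.filter (fun v => ¬ ∀ j, ι j ≠ v)).card := by
    refine Finset.card_le_card_of_injOn ι ?_ hι.injOn
    intro j hj
    have hj' : ι j ∈ D := (Finset.mem_filter.1 (Finset.mem_coe.1 hj)).2
    simp [hj']
  have h1 := Finset.card_filter_add_card_filter_not (s := D) (fun v => ∀ j, ι j ≠ v)
  have h2 := Finset.card_union_le G B
  have h3 := Finset.card_add_card_compl (G ∪ B)
  have h4 : Y.card = (G ∪ B)ᶜ.card := rfl
  have h5 : F.card = (D.filter (fun v => ∀ j, ι j ≠ v)).card := rfl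
  omega

/-! ### Joining linker, grate and reversed linker -/

section Core

variable {Λ A G : Type} [DecidableEq Λ] [DecidableEq G]

/-- A linker into the sources of `F`, the graph `F`, and a reversed linker out of its targets. -/
def coreEdges (E : Finset (Λ × Λ)) (X : Finset (Λ × A)) (F : Finset (G × G)) (src tgt : A → G) :
    Finset ((Λ ⊕ (G ⊕ Λ)) × (Λ ⊕ (G ⊕ Λ))) :=
  E.image (fun p => (.inl p.1, .inl p.2)) ∪
  (X.image (fun p => (.inl p.1, .inr (.inl (src p.2)))) ∪
  (F.image (fun p => (.inr (.inl p.1), .inr (.inl p.2))) ∪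
  (X.image (fun p => (.inr (.inl (tgt p.2)), .inr (.inr p.1))) ∪
  E.image (fun p => (.inr (.inr p.2), .inr (.inr p.1))))))

variable {E : Finset (Λ × Λ)} {X : Finset (Λ × A)} {F : Finset (G × G)} {src tgt : A → G}

theorem card_coreEdges_le :
    (coreEdges E X F src tgt).card ≤ 2 * E.card + 2 * X.card + F.card := by
  have h1 : (E.image (fun p => ((.inl p.1, .inl p.2) :
    (Λ ⊕ (G ⊕ Λ)) × (Λ ⊕ (G ⊕ Λ))))).card ≤ E.card := Finset.card_image_le
  have h2 : (X.image (fun p => ((.inl p.1, .inr (.inl (src p.2))) :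
    (Λ ⊕ (G ⊕ Λ)) × (Λ ⊕ (G ⊕ Λ))))).card ≤ X.card := Finset.card_image_le
  have h3 : (F.image (fun p => ((.inr (.inl p.1), .inr (.inl p.2)) :
    (Λ ⊕ (G ⊕ Λ)) × (Λ ⊕ (G ⊕ Λ))))).card ≤ F.card := Finset.card_image_le
  have h4 : (X.image (fun p => ((.inr (.inl (tgt p.2)), .inr (.inr p.1)) :
    (Λ ⊕ (G ⊕ Λ)) × (Λ ⊕ (G ⊕ Λ))))).card ≤ X.card := Finset.card_image_le
  have h5 : (E.image (fun p => ((.inr (.inr p.2), .inr (.inr p.1)) :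
    (Λ ⊕ (G ⊕ Λ)) × (Λ ⊕ (G ⊕ Λ))))).card ≤ E.card := Finset.card_image_le
  refine (Finset.card_union_le _ _).trans ?_
  refine (Nat.add_le_add_left (Finset.card_union_le _ _) _).trans ?_
  refine (Nat.add_le_add_left (Nat.add_le_add_left (Finset.card_union_le _ _) _) _).trans ?_
  refine (Nat.add_le_add_left (Nat.add_le_add_left (Nat.add_le_add_left
    (Finset.card_union_le _ _) _) _) _).trans ?_
  omega

theorem exists_rank_coreEdges [Fintype Λ] [Fintype G] {f : Λ → ℕ}
    (hf : ∀ u v, (u, v) ∈ E → f u < f v) {g : G → ℕ} (hg : ∀ u v, (u, v) ∈ F → g u < g v) :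
    ∃ rank : Λ ⊕ (G ⊕ Λ) → ℕ, ∀ u v, (u, v) ∈ coreEdges E X F src tgt → rank u < rank v := by
  have hfle : ∀ i, f i ≤ ∑ j, f j := fun i =>
    Finset.single_le_sum (f := f) (fun _ _ => Nat.zero_le _) (Finset.mem_univ i)
  have hgle : ∀ i, g i ≤ ∑ j, g j := fun i =>
    Finset.single_le_sum (f := g) (fun _ _ => Nat.zero_le _) (Finset.mem_univ i)
  -- The last summand reverses the order of `f` for the reversed linker; the truncated subtraction
  -- is exact because `f v` is at most the sum.
  refine ⟨Sum.elim f (Sum.elim (fun v => ∑ j, f j + 1 + g v)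
    (fun v => ∑ j, f j + 1 + ∑ j, g j + 1 + (∑ j, f j - f v))), fun u v huv => ?_⟩
  simp only [coreEdges, Finset.mem_union, Finset.mem_image, Prod.mk.injEq] at huv
  rcases huv with ⟨p, hp, rfl, rfl⟩ | ⟨p, hp, rfl, rfl⟩ | ⟨p, hp, rfl, rfl⟩ | ⟨p, hp, rfl, rfl⟩ |
    ⟨p, hp, rfl, rfl⟩
  · exact hf _ _ hp
  · have := hfle p.1
    simp only [Sum.elim_inl, Sum.elim_inr]
    omega
  · have := hg _ _ hp
    simp only [Sum.elim_inl, Sum.elim_inr]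
    omega
  · have := hgle (tgt p.2)
    simp only [Sum.elim_inl, Sum.elim_inr]
    omega
  · have h1 := hf _ _ hp
    have h2 := hfle p.2
    simp only [Sum.elim_inr]
    omega

end Core

/-- Sparse acyclic graphs with `2 ^ a` inputs and `2 ^ a` outputs in which, whatever set `D` of fewer
than `2 ^ a` vertices is deleted, some vertex is reached from all but `|D|` inputs and reaches all
but `|D|` outputs. -/
theorem exists_core : ∃ C : ℕ, ∀ a : ℕ, ∃ (V : Type) (_ : Fintype V) (E : Finset (V × V))
    (inp out : Fin (2 ^ a) → V), Function.Injective inp ∧ Function.Injective out ∧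
    Fintype.card V ≤ C * 2 ^ a ∧ E.card ≤ C * 2 ^ a ∧
    (∃ rank : V → ℕ, ∀ u v, (u, v) ∈ E → rank u < rank v) ∧
    (∀ u j, (u, inp j) ∉ E) ∧ (∀ u j, (out j, u) ∉ E) ∧
    ∀ D : Finset V, D.card < 2 ^ a → ∃ z ∉ D, ∃ I O : Finset (Fin (2 ^ a)),
      2 ^ a ≤ D.card + I.card ∧ 2 ^ a ≤ D.card + O.card ∧
      (∀ j ∈ I, inp j ∉ D ∧ ReflTransGen (Avoid (fun u v => (u, v) ∈ E) D) (inp j) z) ∧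
      (∀ j ∈ O, out j ∉ D ∧ ReflTransGen (Avoid (fun u v => (u, v) ∈ E) D) z (out j)) := by
  classical
  obtain ⟨C₁, hC₁⟩ := exists_grate
  obtain ⟨C₂, hC₂⟩ := exists_linker
  refine ⟨2 * C₂ + 2 * (C₂ * (1 + C₁)) + C₁, fun a => ?_⟩
  obtain ⟨A, G, _, _, F, src, tgt, hA1, hA2, hG, hF, ⟨g, hg⟩, hcenter⟩ := hC₁ a
  obtain ⟨Λ, _, _, E, X, ι, hι, hΛ, hE, hX, ⟨f, hf⟩, hin, hlink⟩ :=
    hC₂ a A (lt_of_lt_of_le (by positivity) hA1)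
  refine ⟨Λ ⊕ (G ⊕ Λ), inferInstance, coreEdges E X F src tgt, fun j => .inl (ι j),
    fun j => .inr (.inr (ι j)), ?_, ?_, ?_, ?_, exists_rank_coreEdges hf hg, ?_, ?_, ?_⟩
  · intro x y h
    exact hι (Sum.inl_injective h)
  · intro x y h
    exact hι (Sum.inr_injective (Sum.inr_injective h))
  · rw [Fintype.card_sum, Fintype.card_sum]
    nlinarith [Nat.zero_le (C₂ * (1 + C₁) * 2 ^ a)]
  · refine card_coreEdges_le.trans ?_
    have h1 : X.card ≤ C₂ * (1 + C₁) * 2 ^ a := by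
      refine hX.trans ?_
      rw [mul_assoc, add_mul, one_mul]
      exact Nat.mul_le_mul_left _ (by omega)
    nlinarith
  · intro u j h
    simp only [coreEdges, Finset.mem_union, Finset.mem_image, Prod.mk.injEq] at h
    rcases h with ⟨p, hp, -, h⟩ | ⟨p, hp, -, h⟩ | ⟨p, hp, -, h⟩ | ⟨p, hp, -, h⟩ | ⟨p, hp, -, h⟩
    · refine hin p.1 j ?_
      rw [← Sum.inl_injective h]
      exact hp
    all_goals simp at h
  · intro u j h
    simp only [coreEdges, Finset.mem_union, Finset.mem_image, Prod.mk.injEq] at h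
    rcases h with ⟨p, hp, h, -⟩ | ⟨p, hp, h, -⟩ | ⟨p, hp, h, -⟩ | ⟨p, hp, h, -⟩ | ⟨p, hp, h, -⟩
    on_goal 5 =>
      refine hin p.1 j ?_
      rw [← Sum.inr_injective (Sum.inr_injective h)]
      exact hp
    all_goals simp at h
  · intro D hD
    let D₁ : Finset Λ := Finset.univ.filter (fun v => Sum.inl v ∈ D)
    let D₂ : Finset G := Finset.univ.filter (fun v => Sum.inr (Sum.inl v) ∈ D)
    let D₃ : Finset Λ := Finset.univ.filter (fun v => Sum.inr (Sum.inr v) ∈ D)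
    have hD₁ : ∀ v, Sum.inl v ∈ D ↔ v ∈ D₁ := fun v => by simp [D₁]
    have hD₂ : ∀ v, Sum.inr (Sum.inl v) ∈ D ↔ v ∈ D₂ := fun v => by simp [D₂]
    have hD₃ : ∀ v, Sum.inr (Sum.inr v) ∈ D ↔ v ∈ D₃ := fun v => by simp [D₃]
    have hc₁ : D₁.card ≤ D.card := by
      refine Finset.card_le_card_of_injOn Sum.inl ?_ Sum.inl_injective.injOn
      intro v hv
      exact (hD₁ v).2 hv
    have hc₂ : D₂.card ≤ D.card := by
      refine Finset.card_le_card_of_injOn (fun v => Sum.inr (Sum.inl v)) ?_ ?_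
      · intro v hv
        exact (hD₂ v).2 hv
      · intro x _ y _ h
        exact Sum.inl_injective (Sum.inr_injective h)
    have hc₃ : D₃.card ≤ D.card := by
      refine Finset.card_le_card_of_injOn (fun v => Sum.inr (Sum.inr v)) ?_ ?_
      · intro v hv
        exact (hD₃ v).2 hv
      · intro x _ y _ h
        exact Sum.inr_injective (Sum.inr_injective h)
    obtain ⟨z, hz, TA, TB, hTA, hTB, hAz, hzB⟩ := hcenter D₂ (by omega)
    obtain ⟨I, h₁, hI⟩ := hlink.exists_inputs hι D₁ TA hTA
    obtain ⟨O, h₃, hO⟩ := hlink.exists_inputs hι D₃ TB hTB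
    rw [Fintype.card_fin] at h₁ h₃
    set ρ := Avoid (fun u v => (u, v) ∈ coreEdges E X F src tgt) D with hρ
    have hmid : ∀ {x y : G}, ReflTransGen (Avoid (fun u v => (u, v) ∈ F) D₂) x y →
        ReflTransGen ρ (.inr (.inl x)) (.inr (.inl y)) := by
      intro x y hxy
      refine Avoid.lift (fun v : G => (Sum.inr (Sum.inl v) : Λ ⊕ (G ⊕ Λ))) ?_
        (fun v hv => (hD₂ v).1 hv) hxy
      intro u v huv
      simp only [coreEdges, Finset.mem_union, Finset.mem_image]
      exact Or.inr (Or.inr (Or.inl ⟨(u, v), huv, rfl⟩))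
    refine ⟨.inr (.inl z), by rwa [hD₂], I, O, h₁.trans (Nat.add_le_add_right hc₁ _),
      h₃.trans (Nat.add_le_add_right hc₃ _), ?_, ?_⟩
    · intro j hj
      obtain ⟨hjD, v, hv, hjv, t, ht, hvt⟩ := hI j hj
      refine ⟨by rwa [hD₁], ?_⟩
      have hpath : ReflTransGen ρ (.inl (ι j)) (.inl v) := by
        refine Avoid.lift (fun v : Λ => (Sum.inl v : Λ ⊕ (G ⊕ Λ))) ?_
          (fun v hv => (hD₁ v).1 hv) hjv
        intro u v huv
        simp only [coreEdges, Finset.mem_union, Finset.mem_image]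
        exact Or.inl ⟨(u, v), huv, rfl⟩
      obtain ⟨hsD, hsz⟩ := hAz t ht
      refine (hpath.tail ⟨?_, by rwa [hD₁], by rwa [hD₂]⟩).trans (hmid hsz)
      simp only [coreEdges, Finset.mem_union, Finset.mem_image]
      exact Or.inr (Or.inl ⟨(v, t), hvt, rfl⟩)
    · intro j hj
      obtain ⟨hjD, v, hv, hjv, t, ht, hvt⟩ := hO j hj
      refine ⟨by rwa [hD₃], ?_⟩
      have hpath : ReflTransGen (fun x y => ρ y x) (.inr (.inr (ι j))) (.inr (.inr v)) := by
        refine ReflTransGen.lift (p := fun x y => ρ y x)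
          (fun v : Λ => (Sum.inr (Sum.inr v) : Λ ⊕ (G ⊕ Λ))) ?_ _ _ hjv
        intro u v huv
        refine ⟨?_, fun h => huv.2.2 ((hD₃ _).1 h), fun h => huv.2.1 ((hD₃ _).1 h)⟩
        simp only [coreEdges, Finset.mem_union, Finset.mem_image]
        exact Or.inr (Or.inr (Or.inr (Or.inr ⟨(u, v), huv.1, rfl⟩)))
      obtain ⟨hsD, hsz⟩ := hzB t ht
      refine ((hmid hsz).tail ⟨?_, by rwa [hD₂], by rwa [hD₃]⟩).trans (reflTransGen_swap.1 hpath)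
      simp only [coreEdges, Finset.mem_union, Finset.mem_image]
      exact Or.inr (Or.inr (Or.inr (Or.inl ⟨(v, t), hvt, rfl⟩)))

/-! ### From a center to the robust subgraph -/

theorem isAcyclic_of_rank {V α : Type*} [Preorder α] (G : Digraph V) (f : V → α)
    (h : ∀ u v, G.Adj u v → f u < f v) : IsAcyclic G := by
  intro v hv
  have : ∀ u w, TransGen G.Adj u w → f u < f w := by
    intro u w huw
    induction huw with
    | single h' => exact h _ _ h'
    | tail _ h' ih => exact ih.trans (h _ _ h')
  exact lt_irrefl _ (this v v hv)

/-- A vertex reached from many sources and reaching many sinks outside `D` yields a subgraph in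
which all sources and sinks left are connected. -/
theorem exists_subdigraph_of_center {V : Type*} [Finite V] (G : Digraph V) (D : Finset V) {z : V}
    (hz : z ∉ D) {k : ℕ}
    (hI : k ≤ {s | s ∈ sources G ∧ ReflTransGen (Avoid G.Adj D) s z}.ncard)
    (hO : k ≤ {t | t ∈ sinks G ∧ ReflTransGen (Avoid G.Adj D) z t}.ncard) :
    ∃ H : Subdigraph G, Disjoint H.verts (D : Set V) ∧
      k ≤ (sources G ∩ H.verts).ncard ∧ k ≤ (sinks G ∩ H.verts).ncard ∧
      ∀ s ∈ sources G ∩ H.verts, ∀ t ∈ sinks G ∩ H.verts, ReflTransGen H.Adj s t := by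
  set ρ := Avoid G.Adj D
  let W : Set V := {v | ReflTransGen ρ v z ∨ ReflTransGen ρ z v}
  let H : Subdigraph G :=
    { verts := W
      Adj := fun u v => G.Adj u v ∧ u ∈ W ∧ v ∈ W
      adj_sub := fun h => h.1
      tail_mem := fun h => h.2.1
      head_mem := fun h => h.2.2 }
  have hin : ∀ s, ReflTransGen ρ s z → ReflTransGen H.Adj s z := by
    intro s hs
    induction hs using ReflTransGen.head_induction_on with
    | refl => exact .refl
    | head hab hbz ih => exact .head ⟨hab.1, Or.inl (.head hab hbz), Or.inl hbz⟩ ih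
  have hout : ∀ t, ReflTransGen ρ z t → ReflTransGen H.Adj z t := by
    intro t ht
    induction ht with
    | refl => exact .refl
    | tail hzb hbc ih => exact .tail ih ⟨hbc.1, Or.inr hzb, Or.inr (.tail hzb hbc)⟩
  refine ⟨H, ?_, hI.trans (Set.ncard_le_ncard (fun s hs => ⟨hs.1, Or.inl hs.2⟩)),
    hO.trans (Set.ncard_le_ncard (fun s hs => ⟨hs.1, Or.inr hs.2⟩)), ?_⟩
  · rw [Set.disjoint_left]
    rintro v (hv | hv) hvD
    · rcases hv.cases_head with rfl | ⟨w, hw, -⟩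
      · exact hz hvD
      · exact hw.2.1 hvD
    · rcases hv.cases_tail with rfl | ⟨w, -, hw⟩
      · exact hz hvD
      · exact hw.2.2 hvD
  · rintro s ⟨hs, hsW⟩ t ⟨ht, htW⟩
    have hsz : ReflTransGen ρ s z := by
      rcases hsW with h | h
      · exact h
      · rcases h.cases_tail with rfl | ⟨w, -, hw⟩
        -- A source that `z` reaches can only be `z` itself; dually for sinks below.
        · exact .refl
        · exact absurd hw.1 (hs w)
    have hzt : ReflTransGen ρ z t := by
      rcases htW with h | h
      · rcases h.cases_head with rfl | ⟨w, hw, -⟩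
        · exact .refl
        · exact absurd hw.1 (ht w)
      · exact h
    exact (hin s hsz).trans (hout t hzt)

/-! ### Reducing the indegree to two -/

section Reduction

variable {P : Type} (r : P → P → Prop) (κ : P → ℕ)

/-- Replace each vertex by a path through its entering edges. -/
def reduction : Digraph (P ⊕ {e : P × P // r e.1 e.2}) where
  Adj
    | .inl _, .inl _ => False
    | .inl u, .inr e => u = e.1.1
    | .inr e, .inr e' => e.1.2 = e'.1.2 ∧ κ e.1.1 < κ e'.1.1 ∧
        ∀ x, r x e.1.2 → ¬ (κ e.1.1 < κ x ∧ κ x < κ e'.1.1)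
    | .inr e, .inl v => e.1.2 = v ∧ ∀ x, r x v → κ x ≤ κ e.1.1

/-- The vertex to whose path a vertex of the reduction belongs. -/
def reductionHead : P ⊕ {e : P × P // r e.1 e.2} → P := Sum.elim id (fun e => e.1.2)

variable {r κ}

theorem reduction_isAcyclic {f : P → ℕ} (hf : ∀ u v, r u v → f u < f v) :
    IsAcyclic (reduction r κ) := by
  -- The path replacing `v` lies at height `f v`, ordered by `κ` of the tails, with `v` itself on
  -- top.
  let g : P ⊕ {e : P × P // r e.1 e.2} → ℕ ×ₗ WithTop ℕ :=
    Sum.elim (fun v => toLex (f v, ⊤)) (fun e => toLex (f e.1.2, (κ e.1.1 : WithTop ℕ)))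
  refine isAcyclic_of_rank _ g ?_
  rintro (u | e) (v | e') h
  · exact h.elim
  · have h : u = e'.1.1 := h
    subst h
    exact Prod.Lex.toLex_lt_toLex.2 (Or.inl (hf _ _ e'.2))
  · have h := h.1
    subst h
    exact Prod.Lex.toLex_lt_toLex.2 (Or.inr ⟨rfl, WithTop.coe_lt_top _⟩)
  · exact Prod.Lex.toLex_lt_toLex.2 (Or.inr ⟨congrArg f h.1, WithTop.coe_lt_coe.2 h.2.1⟩)

/-- An edge vertex is entered from its tail and from at most one preceding edge of its path; an old
vertex is entered only from the last edge. Injectivity of `κ` makes both unique. -/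
theorem reduction_indegree_le (hκ : Function.Injective κ)
    (v : P ⊕ {e : P × P // r e.1 e.2}) : indegree (reduction r κ) v ≤ 2 := by
  obtain v | e := v
  · have hs : {u | (reduction r κ).Adj u (.inl v)}.Subsingleton := by
      rintro (u | e) hu (u' | e') hu'
      · exact hu.elim
      · exact hu.elim
      · exact hu'.elim
      · have h1 : κ e.1.1 = κ e'.1.1 := le_antisymm
          (hu'.2 _ (by have := e.2; rwa [hu.1] at this))
          (hu.2 _ (by have := e'.2; rwa [hu'.1] at this))
        have h2 : e.1 = e'.1 := Prod.ext (hκ h1) (hu.1.trans hu'.1.symm)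
        rw [Subtype.ext h2]
    exact ((Set.ncard_le_one hs.finite).2 hs).trans one_le_two
  · let T : Set (P ⊕ {e : P × P // r e.1 e.2}) :=
      {u | (reduction r κ).Adj u (.inr e) ∧ ∃ e', u = .inr e'}
    have hs : T.Subsingleton := by
      rintro _ ⟨hu, e₁, rfl⟩ _ ⟨hu', e₂, rfl⟩
      have r₁ : r e₁.1.1 e₂.1.2 := by
        have := e₁.2
        rwa [hu.1, ← hu'.1] at this
      have r₂ : r e₂.1.1 e₁.1.2 := by
        have := e₂.2
        rwa [hu'.1, ← hu.1] at this
      have h1 : κ e₁.1.1 = κ e₂.1.1 := by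
        rcases lt_trichotomy (κ e₁.1.1) (κ e₂.1.1) with h | h | h
        · exact absurd ⟨h, hu'.2.1⟩ (hu.2.2 _ r₂)
        · exact h
        · exact absurd ⟨h, hu.2.1⟩ (hu'.2.2 _ r₁)
      have h2 : e₁.1 = e₂.1 := Prod.ext (hκ h1) (hu.1.trans hu'.1.symm)
      rw [Subtype.ext h2]
    have hsub : {u | (reduction r κ).Adj u (.inr e)} ⊆ insert (.inl e.1.1) T := by
      rintro (u | e') hu
      · have hu : u = e.1.1 := hu
        rw [hu]
        exact Set.mem_insert _ _
      · exact Set.mem_insert_of_mem _ ⟨hu, e', rfl⟩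
    refine (Set.ncard_le_ncard hsub (hs.finite.insert _)).trans ((Set.ncard_insert_le _ _).trans ?_)
    have := (Set.ncard_le_one hs.finite).2 hs
    omega

/-- Every entering edge of `v` leads to `v` along the path that replaces `v`. -/
theorem reduction_reaches_head [Fintype P] {D : Finset (P ⊕ {e : P × P // r e.1 e.2})} {v : P}
    (hD : ∀ w ∈ D, reductionHead r w ≠ v) (e : {e : P × P // r e.1 e.2}) (he : e.1.2 = v) :
    ReflTransGen (Avoid (reduction r κ).Adj D) (.inr e) (.inl v) := by
  classical
  have hD₁ : (Sum.inl v : P ⊕ {e : P × P // r e.1 e.2}) ∉ D := fun h => hD _ h rfl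
  have hD₂ : ∀ e : {e : P × P // r e.1 e.2}, e.1.2 = v →
      (Sum.inr e : P ⊕ {e : P × P // r e.1 e.2}) ∉ D := fun e he h => hD _ h he
  -- Induction on the number of entering edges still ahead on the path.
  induction hn : (Finset.univ.filter (fun x => r x v ∧ κ e.1.1 < κ x)).card
    using Nat.strong_induction_on generalizing e with
  | _ n ih =>
    rcases (Finset.univ.filter (fun x => r x v ∧ κ e.1.1 < κ x)).eq_empty_or_nonempty with h0 | h0
    · refine .single ⟨⟨he, fun x hx => ?_⟩, hD₂ e he, hD₁⟩
      by_contra! hcon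
      have : x ∈ Finset.univ.filter (fun x => r x v ∧ κ e.1.1 < κ x) := by simp [hx, hcon]
      rw [h0] at this
      simp at this
    · obtain ⟨x, hx, hmin⟩ := Finset.exists_min_image _ κ h0
      simp only [Finset.mem_filter, Finset.mem_univ, true_and] at hx hmin
      let e' : {e : P × P // r e.1 e.2} := ⟨(x, v), hx.1⟩
      have hstep : Avoid (reduction r κ).Adj D (.inr e) (.inr e') := by
        refine ⟨⟨he, hx.2, fun y hy hy' => ?_⟩, hD₂ e he, hD₂ e' rfl⟩
        rw [he] at hy
        exact absurd (hmin y ⟨hy, hy'.1⟩) (not_le.2 hy'.2)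
      refine .head hstep (ih _ ?_ e' rfl rfl)
      rw [← hn]
      refine Finset.card_lt_card ?_
      rw [Finset.ssubset_iff_of_subset]
      · exact ⟨x, by simpa using hx, by simp [e']⟩
      · intro y hy
        simp only [Finset.mem_filter, Finset.mem_univ, true_and] at hy ⊢
        exact ⟨hy.1, hx.2.trans hy.2⟩

/-- Deleting any vertex of the path of `v` counts as deleting `v`, so paths that avoid `D'` run only
through intact replacement paths. -/
theorem reduction_reaches [Fintype P] {D : Finset (P ⊕ {e : P × P // r e.1 e.2})} {D' : Finset P}
    (hD : ∀ w ∈ D, reductionHead r w ∈ D') {u v : P} (h : ReflTransGen (Avoid r D') u v) :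
    ReflTransGen (Avoid (reduction r κ).Adj D) (.inl u) (.inl v) := by
  induction h with
  | refl => exact .refl
  | @tail b c _ hbc ih =>
    have hc : ∀ w ∈ D, reductionHead r w ≠ c := fun w hw h => hbc.2.2 (h ▸ hD w hw)
    have hstep : Avoid (reduction r κ).Adj D (.inl b) (.inr ⟨(b, c), hbc.1⟩) :=
      ⟨rfl, fun h => hbc.2.1 (hD _ h), fun h => hc _ h rfl⟩
    exact ih.trans (.head hstep (reduction_reaches_head hc ⟨(b, c), hbc.1⟩ rfl))

theorem sources_reduction [Fintype P] :
    sources (reduction r κ) = Sum.inl '' {v | ∀ u, ¬ r u v} := by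
  classical
  ext (v | e)
  · constructor
    · intro h
      refine ⟨v, fun u hu => ?_, rfl⟩
      have := reduction_reaches_head (κ := κ) (D := ∅) (v := v) (by simp) ⟨(u, v), hu⟩ rfl
      rcases this.cases_tail with h' | ⟨w, -, hw⟩
      · simp at h'
      · exact h w hw.1
    · rintro ⟨v', hv, h⟩
      rw [Sum.inl_injective h] at hv
      rintro (u | e) hu
      · exact hu
      · exact hv e.1.1 (by have := e.2; rwa [hu.1] at this)
  · constructor
    · intro h
      exact absurd rfl (h (.inl e.1.1))
    · rintro ⟨v', -, h⟩
      simp at h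

theorem sinks_reduction [Fintype P] :
    sinks (reduction r κ) = Sum.inl '' {v | ∀ u, ¬ r v u} := by
  classical
  ext (v | e)
  · constructor
    · intro h
      exact ⟨v, fun u hu => h (.inr ⟨(v, u), hu⟩) rfl, rfl⟩
    · rintro ⟨v', hv, h⟩
      rw [Sum.inl_injective h] at hv
      rintro (u | e) hu
      · exact hu
      · have hu : v = e.1.1 := hu
        exact hv e.1.2 (by rw [hu]; exact e.2)
  · constructor
    · intro h
      have := reduction_reaches_head (κ := κ) (D := ∅) (v := e.1.2) (by simp) e rfl
      rcases this.cases_head with h' | ⟨w, hw, -⟩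
      · simp at h'
      · exact absurd hw.1 (h w)
    · rintro ⟨v', -, h⟩
      simp at h

end Reduction

/-! ### Arbitrary `n`, trimming and the final assembly -/

theorem card_le_add_card_filter {m n d : ℕ} (f : Fin n ↪ Fin m) (I : Finset (Fin m))
    (hI : m ≤ d + I.card) : n ≤ d + (Finset.univ.filter (fun j => f j ∈ I)).card := by
  have h1 := Finset.card_compl I
  have h2 := Finset.card_compl (Finset.univ.filter (fun j => f j ∈ I))
  have h3 : ((Finset.univ.filter (fun j => f j ∈ I))ᶜ.map f).card ≤ Iᶜ.card := by
    refine Finset.card_le_card fun x hx => ?_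
    obtain ⟨j, hj, rfl⟩ := Finset.mem_map.1 hx
    simpa using hj
  rw [Finset.card_map] at h3
  simp only [Fintype.card_fin] at h1 h2
  omega

/-- A linear-size acyclic graph with `n` inputs and `n` outputs in which, after deleting fewer
than `n` vertices `D`, some vertex is reached by `n - |D|` inputs and reaches `n - |D|` outputs. -/
theorem exists_core_of_pos : ∃ C : ℕ, ∀ n : ℕ, 1 ≤ n →
    ∃ (V : Type) (_ : Fintype V) (E : Finset (V × V))
    (inp out : Fin n → V), Function.Injective inp ∧ Function.Injective out ∧
    Fintype.card V ≤ C * n ∧ E.card ≤ C * n ∧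
    (∃ rank : V → ℕ, ∀ u v, (u, v) ∈ E → rank u < rank v) ∧
    (∀ u j, (u, inp j) ∉ E) ∧ (∀ u j, (out j, u) ∉ E) ∧
    ∀ D : Finset V, D.card < n → ∃ z ∉ D, ∃ I O : Finset (Fin n),
      n ≤ D.card + I.card ∧ n ≤ D.card + O.card ∧
      (∀ j ∈ I, ReflTransGen (Avoid (fun u v => (u, v) ∈ E) D) (inp j) z) ∧
      (∀ j ∈ O, ReflTransGen (Avoid (fun u v => (u, v) ∈ E) D) z (out j)) := by
  obtain ⟨C, hC⟩ := exists_core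
  refine ⟨C * 2, fun n hn => ?_⟩
  obtain ⟨a, hna, han⟩ : ∃ a, n ≤ 2 ^ a ∧ 2 ^ a ≤ 2 * n := by
    refine ⟨Nat.log 2 n + 1, (Nat.lt_pow_succ_log_self one_lt_two n).le, ?_⟩
    have := Nat.pow_log_le_self 2 (x := n) (by omega)
    rw [pow_succ]
    omega
  obtain ⟨V, _, E, inp, out, hinp, hout, hV, hE, hrank, hsrc, hsnk, hD⟩ := hC a
  have hCn : C * 2 ^ a ≤ C * 2 * n := by
    rw [mul_assoc]
    exact Nat.mul_le_mul_left _ han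
  let f : Fin n ↪ Fin (2 ^ a) := Fin.castLEEmb hna
  refine ⟨V, inferInstance, E, inp ∘ f, out ∘ f, hinp.comp f.injective, hout.comp f.injective,
    hV.trans hCn, hE.trans hCn, hrank, fun u j => hsrc u _, fun u j => hsnk u _, fun D hDn => ?_⟩
  obtain ⟨z, hz, I, O, hI, hO, hIz, hOz⟩ := hD D (hDn.trans_le hna)
  exact ⟨z, hz, Finset.univ.filter (fun j => f j ∈ I), Finset.univ.filter (fun j => f j ∈ O),
    card_le_add_card_filter f I hI, card_le_add_card_filter f O hO,
    fun j hj => (hIz _ (Finset.mem_filter.1 hj).2).2,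
    fun j hj => (hOz _ (Finset.mem_filter.1 hj).2).2⟩

theorem Avoid.reflTransGen {V : Type*} {r : V → V → Prop} {D : Finset V} {u v : V}
    (h : ReflTransGen (Avoid r D) u v) : ReflTransGen r u v :=
  ReflTransGen.mono (fun _ _ h => h.1) _ _ h

/-- Paths between vertices of a convex set of vertices stay in it. -/
theorem Avoid.subtype {V : Type*} {r : V → V → Prop} {p : V → Prop}
    (hp : ∀ u w v, p u → r u w → ReflTransGen r w v → p v → p w) {D : Finset V}
    {D' : Finset (Subtype p)} (hD : ∀ x ∈ D', x.1 ∈ D) {u v : V} (hu : p u) (hv : p v)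
    (h : ReflTransGen (Avoid r D) u v) :
    ReflTransGen (Avoid (fun x y : Subtype p => r x y) D') ⟨u, hu⟩ ⟨v, hv⟩ := by
  induction h using ReflTransGen.head_induction_on with
  | refl => exact .refl
  | head hab hbv ih =>
    have hb := hp _ _ _ hu hab.1 (Avoid.reflTransGen hbv) hv
    have hstep : Avoid (fun x y : Subtype p => r x y) D' ⟨_, hu⟩ ⟨_, hb⟩ :=
      ⟨hab.1, fun h => hab.2.1 (hD _ h), fun h => hab.2.2 (hD _ h)⟩
    exact .head hstep (ih hb)

/-- The core may have sources and sinks other than its inputs and outputs. Trimming it to the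
vertices on paths from an input to an output removes them, and by convexity no path between kept
vertices is lost; then the indegree is reduced. -/
theorem exists_maximallySTRobust : ∃ c : ℕ, ∀ n : ℕ, 1 ≤ n →
    ∃ (V : Type) (_ : Fintype V) (M : Digraph V), IsAcyclic M ∧ (∀ v, indegree M v ≤ 2) ∧
      Fintype.card V ≤ c * n ∧ IsMaximallySTRobust M (sources M) (sinks M) n := by
  classical
  obtain ⟨C, hC⟩ := exists_core_of_pos
  refine ⟨C + C, fun n hn => ?_⟩
  obtain ⟨V, _, E, inp, out, hinp, hout, hV, hE, ⟨rank, hrank⟩, hsrc, hsnk, hD⟩ := hC n hn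
  set ρ : V → V → Prop := fun u v => (u, v) ∈ E with hρ
  -- With `D = ∅` no input or output is lost, so all pairs are connected; this keeps every input and
  -- output in the trimmed graph.
  have hio : ∀ i j, ReflTransGen ρ (inp i) (out j) := by
    obtain ⟨z, -, I, O, hI, hO, hIz, hOz⟩ := hD ∅ (Finset.card_empty.trans_lt hn)
    have huniv : ∀ S : Finset (Fin n), n ≤ (∅ : Finset V).card + S.card → ∀ j, j ∈ S := by
      intro S hS j
      have : S = Finset.univ := by
        rw [← Finset.card_eq_iff_eq_univ, Fintype.card_fin]
        have := Finset.card_le_univ S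
        simp only [Fintype.card_fin, Finset.card_empty] at this hS
        omega
      rw [this]
      exact Finset.mem_univ j
    exact fun i j => (Avoid.reflTransGen (hIz i (huniv I hI i))).trans
      (Avoid.reflTransGen (hOz j (huniv O hO j)))
  let p : V → Prop := fun v =>
    (∃ j, ReflTransGen ρ (inp j) v) ∧ ∃ j, ReflTransGen ρ v (out j)
  have hp : ∀ u w v, p u → ρ u w → ReflTransGen ρ w v → p v → p w := by
    rintro u w v ⟨⟨i, hi⟩, -⟩ huw hwv ⟨-, ⟨j, hj⟩⟩
    exact ⟨⟨i, hi.tail huw⟩, ⟨j, hwv.trans hj⟩⟩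
  have hpi : ∀ j, p (inp j) := fun j => ⟨⟨j, .refl⟩, ⟨j, hio j j⟩⟩
  have hpo : ∀ j, p (out j) := fun j => ⟨⟨j, hio j j⟩, ⟨j, .refl⟩⟩
  let P : Type := Subtype p
  let r : P → P → Prop := fun x y => ρ x y
  let κ : P → ℕ := fun x => (Fintype.equivFin V x.1 : ℕ)
  have hκ : Function.Injective κ := fun x y hxy =>
    Subtype.ext ((Fintype.equivFin V).injective (Fin.ext hxy))
  let inpP : Fin n → P := fun j => ⟨inp j, hpi j⟩
  let outP : Fin n → P := fun j => ⟨out j, hpo j⟩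
  have hinpP : Function.Injective inpP := fun i j h => hinp (congrArg Subtype.val h)
  have houtP : Function.Injective outP := fun i j h => hout (congrArg Subtype.val h)
  have hsources : sources (reduction r κ) = Set.range (Sum.inl ∘ inpP) := by
    rw [sources_reduction, Set.range_comp]
    congr 1
    ext ⟨v, hv⟩
    constructor
    · intro h
      obtain ⟨⟨i, hi⟩, -⟩ := id hv
      rcases hi.cases_tail with h' | ⟨w, hiw, hwv⟩
      · exact ⟨i, Subtype.ext h'.symm⟩
      · have hw : p w := by
          obtain ⟨-, j, hj⟩ := id hv
          exact ⟨⟨i, hiw⟩, ⟨j, .head hwv hj⟩⟩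
        exact absurd hwv (h ⟨w, hw⟩)
    · rintro ⟨j, hj⟩ u hu
      refine hsrc u j ?_
      have : inp j = v := congrArg Subtype.val hj
      rw [this]
      exact hu
  have hsinks : sinks (reduction r κ) = Set.range (Sum.inl ∘ outP) := by
    rw [sinks_reduction, Set.range_comp]
    congr 1
    ext ⟨v, hv⟩
    constructor
    · intro h
      obtain ⟨-, i, hi⟩ := id hv
      rcases hi.cases_head with h' | ⟨w, hvw, hwi⟩
      · exact ⟨i, Subtype.ext h'.symm⟩
      · have hw : p w := by
          obtain ⟨⟨j, hj⟩, -⟩ := id hv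
          exact ⟨⟨j, hj.tail hvw⟩, ⟨i, hwi⟩⟩
        exact absurd hvw (h ⟨w, hw⟩)
    · rintro ⟨j, hj⟩ u hu
      refine hsnk u j ?_
      have : out j = v := congrArg Subtype.val hj
      rw [this]
      exact hu
  have hinpW : Function.Injective (Sum.inl ∘ inpP : Fin n → P ⊕ {e : P × P // r e.1 e.2}) :=
    Sum.inl_injective.comp hinpP
  have houtW : Function.Injective (Sum.inl ∘ outP : Fin n → P ⊕ {e : P × P // r e.1 e.2}) :=
    Sum.inl_injective.comp houtP
  refine ⟨P ⊕ {e : P × P // r e.1 e.2}, inferInstance, reduction r κ,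
    reduction_isAcyclic (f := fun x => rank x.1) (fun u v h => hrank _ _ h),
    reduction_indegree_le hκ, ?_, ?_, ?_, ?_⟩
  · rw [Fintype.card_sum, add_mul]
    refine add_le_add ((Fintype.card_subtype_le p).trans hV) (le_trans ?_ hE)
    rw [← Fintype.card_coe E]
    refine Fintype.card_le_of_injective
      (fun e : {e : P × P // r e.1 e.2} => (⟨(e.1.1.1, e.1.2.1), e.2⟩ : E)) ?_
    intro e e' h
    have h := congrArg Subtype.val h
    exact Subtype.ext (Prod.ext (Subtype.ext (congrArg Prod.fst h))
      (Subtype.ext (congrArg Prod.snd h)))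
  · rw [hsources, ← Set.image_univ, Set.ncard_image_of_injective _ hinpW, Set.ncard_univ,
      Nat.card_fin]
  · rw [hsinks, ← Set.image_univ, Set.ncard_image_of_injective _ houtW, Set.ncard_univ,
      Nat.card_fin]
  · intro k hk D hDk
    rcases hk.eq_or_lt with rfl | hkn
    -- The core requires fewer than `n` deletions, but for `k = n` nothing is demanded and the empty
    -- subgraph will do.
    · exact ⟨⟨∅, fun _ _ => False, False.elim, False.elim, False.elim⟩, by simp, by simp, by simp,
        fun s hs => absurd hs.2 (Set.notMem_empty s)⟩
    let DP : Finset P := D.image (reductionHead r)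
    let DV : Finset V := DP.image Subtype.val
    have hDP : ∀ w ∈ D, reductionHead r w ∈ DP := fun w hw => Finset.mem_image_of_mem _ hw
    have hDV : ∀ x ∈ DP, x.1 ∈ DV := fun x hx => Finset.mem_image_of_mem _ hx
    have hcard : DV.card ≤ k := Finset.card_image_le.trans (Finset.card_image_le.trans hDk)
    obtain ⟨z, hz, I, O, hI, hO, hIz, hOz⟩ := hD DV (hcard.trans_lt hkn)
    obtain ⟨i, hi⟩ : I.Nonempty := Finset.card_pos.1 (by omega)
    obtain ⟨o, ho⟩ : O.Nonempty := Finset.card_pos.1 (by omega)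
    have hpz : p z := ⟨⟨i, Avoid.reflTransGen (hIz i hi)⟩, ⟨o, Avoid.reflTransGen (hOz o ho)⟩⟩
    refine exists_subdigraph_of_center (reduction r κ) D (z := Sum.inl ⟨z, hpz⟩) ?_ ?_ ?_
    · intro h
      exact hz (hDV _ (hDP _ h))
    · have hle : n - k ≤ I.card := by omega
      refine hle.trans ?_
      rw [← Set.ncard_coe_finset I, ← Set.ncard_image_of_injective _ hinpW]
      refine Set.ncard_le_ncard ?_
      rintro _ ⟨j, hj, rfl⟩
      exact ⟨hsources ▸ Set.mem_range_self j,
        reduction_reaches hDP (Avoid.subtype hp hDV (hpi j) hpz (hIz j hj))⟩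
    · have hle : n - k ≤ O.card := by omega
      refine hle.trans ?_
      rw [← Set.ncard_coe_finset O, ← Set.ncard_image_of_injective _ houtW]
      refine Set.ncard_le_ncard ?_
      rintro _ ⟨j, hj, rfl⟩
      exact ⟨hsinks ▸ Set.mem_range_self j,
        reduction_reaches hDP (Avoid.subtype hp hDV hpz (hpo j) (hOz j hj))⟩

end STRobust

theorem mainTheorem2 :
    ∃ (c δ : ℕ) (V : ℕ → Type) (_ : ∀ n, Fintype (V n)) (M : ∀ n, Digraph (V n)),
      ∀ n : ℕ, 1 ≤ n →
        STRobust.IsAcyclic (M n) ∧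
        (∀ v : V n, STRobust.indegree (M n) v ≤ δ) ∧
        Fintype.card (V n) ≤ c * n ∧
        STRobust.IsMaximallySTRobust (M n) (STRobust.sources (M n)) (STRobust.sinks (M n)) n := by
  obtain ⟨c, hc⟩ := STRobust.exists_maximallySTRobust
  have hc' : ∀ n : ℕ, ∃ (V : Type) (_ : Fintype V) (M : Digraph V), 1 ≤ n →
      STRobust.IsAcyclic M ∧ (∀ v, STRobust.indegree M v ≤ 2) ∧ Fintype.card V ≤ c * n ∧
        STRobust.IsMaximallySTRobust M (STRobust.sources M) (STRobust.sinks M) n := by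
    intro n
    by_cases hn : 1 ≤ n
    · obtain ⟨V, hV, M, hM⟩ := hc n hn
      exact ⟨V, hV, M, fun _ => hM⟩
    -- The family is indexed by all naturals, so `n = 0` gets an arbitrary graph.
    · exact ⟨Unit, inferInstance, ⊥, fun h => absurd h hn⟩
  choose V hV M hM using hc'
  exact ⟨c, 2, V, hV, M, hM⟩
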